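/- **Machine model.** $M(v)$, $v$ a power of two, consists of $v$ processing elements (PEs) $P_0,\dots,P_{v-1}$ with private memories. An algorithm is a sequence of *supersteps* with labels $i$, $0\le i<\log_2 v$; in an $i$-superstep every PE performs local computation and then sends constant-size messages (one matrix element each) to PEs whose index agrees with its own in the $i$ most significant bits; messages are available after the superstep. *Folding* onto $M(p)$, $p\le v$ a power of two, lets $P_j$ of $M(p)$ carry out the work of the $v/p$ consecutive PEs starting with $P_{j(v/p)}$; supersteps with label $\ge\log_2 p$ and messages between PEs with the same host become local computation. The algorithms are *static semiring algorithms*: supersteps, labels, sources and destinations of messages depend only on the input size, and matrix elements are only handled by semiring operations (correctly over every semiring). On $M(p)$, the degree $h^s(n,p)$ of a superstep $s$ is the maximum number of messages sent or received by a PE, $F^i(n,p)$ is the sum of $h^s(n,p)$ over all $i$-supersteps $s$, $S^i(n)$ is the number of $i$-supersteps, and for $\sigma\ge 0$ the communication complexity on $M(p,\sigma)$ is $$H(n,p,\sigma)=\sum_{i=0}^{\log_2 p-1}\bigl(F^i(n,p)+S^i(n)\,\sigma\bigr).$$ An algorithm specified on $M(v(n))$ is $(\alpha,p)$-*wise*,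 for $0<\alpha\le1$ and $1<p\le v(n)$, if its foldings satisfy $\sum_{i<j}F^i(n,2^j)\ge\alpha\frac{p}{2^j}\sum_{i<j}F^i(n,p)$ for all $1\le j\le\log_2 p$ and all $n$. We write $\log x=\max\{1,\log_2 x\}$. **Problem and class.** The $n$-MM problem is to multiply two $\sqrt n\times\sqrt n$ matrices $A,B$; $n$ is an even power of two, $n\ge 4$. $\mathscr C$ is the class of static semiring algorithms for the $n$-MM problem such that, if there are $q$ PEs, (i) no entry of $A$ or $B$ is initially replicated (the initial distribution is otherwise arbitrary), (ii) no PE computes more than $n^{3/2}/\min\{q,11^3\}$ of the multiplicative terms $A[i,k]\cdot B[k,j]$, (iii) all foldings onto $q'$ PEs, $2\le q'<q$, also belong to $\mathscr C$. An algorithm in $\mathscr C$ for $p$ PEs is $\beta$-*optimal* on $M(p,\sigma)$ with respect to $\mathscr C$, $0<\beta\le 1$, if its communication complexity satisfies $H(n,p,\sigma)\le\frac1\beta H'(n,p,\sigma)$ for every $n$ and the communication complexity $H'$ of every algorithm in $\mathscr C$ for $p$ PEs. **Algorithm.** It is specified on $M(n)$; each of $A$, $B$ and the output $C$ is distributed in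 an arbitrary way with one entry per PE. It multiplies recursively: (1) split the PEs into eight segments $S_{hk\ell}$, $h,k,\ell\in\{0,1\}$, of consecutive PEs of equal number, and spread copies of the quadrants $A_{h\ell}$ and $B_{\ell k}$ evenly over $S_{hk\ell}$; (2) recursively compute $M_{hk\ell}=A_{h\ell}B_{\ell k}$ within $S_{hk\ell}$; (3) the PE responsible for an entry of the quadrant $C_{hk}$ collects the corresponding entries of $M_{hk0}$ and $M_{hk1}$ and adds them. The recursion has $\lceil(\log_2 n)/3\rceil$ levels $i=0,1,\dots$, after which each PE solves its subproblems sequentially; if $3\nmid\log_2 n$, the segments at the last level have two or four PEs, and each PE is assigned four or two consecutive ones of the eight subproblems. At level $i$, steps (1) and (3) are $3i$-supersteps, and a further $0$-superstep, for the last additions, ends the algorithm. In each $3i$-superstep, moreover, $P_j$ sends $2^i$ dummy messages to $P_{j+n/2^{3i+1}}$, for $0\le j<n/2^{3i+1}$. **Theorem.** The algorithm belongs to $\mathscr C$, and its communication complexity on $M(p,\sigma)$ (that is, that of its folding onto $p$ PEs) is $$H_{\mathrm{MM}}(n,p,\sigma)=O\!\left(\frac{n}{p^{2/3}}+\sigma\log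 p\right)$$ for every power of two $1<p\le n$ and every $\sigma\ge0$. The algorithm is $(\Theta(1),n)$-wise. It is $\Theta(1)$-optimal with respect to $\mathscr C$ on every $M(p,\sigma)$ with $p$ a power of two, $1<p\le n$, and $\sigma=O\bigl(n/(p^{2/3}\log p)\bigr)$: for every $K>0$ there is $\beta\in(0,1]$, depending only on $K$, such that the folding of the algorithm onto $p$ PEs is in $\mathscr C$ and is $\beta$-optimal on $M(p,\sigma)$ whenever $0\le\sigma\le K\,n/(p^{2/3}\log p)$. All constants are independent of $n$, $p$, $\sigma$ and of the initial and final distributions. -/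

import Mathlib

/-! ### The machine `M(v)` and static semiring algorithms

Throughout a machine has `v = 2 ^ k` processing elements (PEs), indexed by `Fin (2 ^ k)`. -/

/-- The entries of the two `N × N` input matrices `A` and `B`. -/
inductive Entry (N : ℕ) where
  | A (i j : Fin N) : Entry N
  | B (i j : Fin N) : Entry N

/-- The value of an entry on the instance `(A, B)`. -/
def Entry.val {N : ℕ} {S : Type} (A B : Matrix (Fin N) (Fin N) S) : Entry N → S
  | .A i j => A i j
  | .B i j => B i j

/-- The local operations of a PE: semiring operations on its registers.
The first argument is the register that receives the result. -/
inductive Instr (Reg : Type) where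
  | zero (d : Reg) : Instr Reg
  | one (d : Reg) : Instr Reg
  | add (d x y : Reg) : Instr Reg
  | mul (d x y : Reg) : Instr Reg

/-- Renaming of registers. -/
def Instr.rename {Reg Reg' : Type} (f : Reg → Reg') : Instr Reg → Instr Reg'
  | .zero d => .zero (f d)
  | .one d => .one (f d)
  | .add d x y => .add (f d) (f x) (f y)
  | .mul d x y => .mul (f d) (f x) (f y)

open Classical in
/-- Effect of one operation on the local memory of a PE. -/
noncomputable def Instr.exec {Reg S : Type} [Semiring S] (mem : Reg → S) :
    Instr Reg → Reg → S
  | .zero d => Function.update mem d 0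
  | .one d => Function.update mem d 1
  | .add d x y => Function.update mem d (mem x + mem y)
  | .mul d x y => Function.update mem d (mem x * mem y)

/-- Effect of a sequence of operations on the local memory of a PE. -/
noncomputable def runCode {Reg S : Type} [Semiring S] (code : List (Instr Reg))
    (mem : Reg → S) : Reg → S :=
  code.foldl Instr.exec mem

/-- A message: PE `src` sends the content of its register `srcReg` (one semiring element) to
PE `dst`, where it becomes available in register `dstReg` after the barrier. -/
structure Message (k : ℕ) (Reg : Type) where
  src : Fin (2 ^ k)
  dst : Fin (2 ^ k)
  srcReg : Reg
  dstReg : Reg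

/-- One step of an algorithm for `M(2 ^ k)`: every PE executes its local code, then the messages
are exchanged.  A step with `label < k` is a superstep, closed by a barrier of that label.
A step with `label ≥ k` is local computation: by `cluster`, all its "messages" stay within a PE
(they are local copies), and it is no superstep of `M(2 ^ k)`. -/
structure Step (k : ℕ) (Reg : Type) where
  label : ℕ
  code : Fin (2 ^ k) → List (Instr Reg)
  msgs : Finset (Message k Reg)
  /-- Different messages to a PE are stored in different registers. -/
  tagged : ∀ μ ∈ msgs, ∀ ν ∈ msgs, μ.dst = ν.dst → μ.dstReg = ν.dstReg → μ = ν
  /-- Sender and receiver of a message agree in the `label` most significant bits of their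
  `k`-bit indices. -/
  cluster : ∀ μ ∈ msgs, μ.src.val / 2 ^ (k - label) = μ.dst.val / 2 ^ (k - label)

open Classical in
/-- Effect of a step on the global memory: local code, then delivery of the messages. -/
noncomputable def Step.exec {k : ℕ} {Reg S : Type} [Semiring S]
    (mem : Fin (2 ^ k) → Reg → S) (st : Step k Reg) : Fin (2 ^ k) → Reg → S :=
  let loc : Fin (2 ^ k) → Reg → S := fun r => runCode (st.code r) (mem r)
  fun r d =>
    if h : ∃ μ ∈ st.msgs, μ.dst = r ∧ μ.dstReg = d then
      loc h.choose.src h.choose.srcReg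
    else loc r d

/-- The degree of a step: the maximum number of messages sent or received by any PE.
A message from a PE to itself is local and does not count. -/
def Step.degree {k : ℕ} {Reg : Type} (st : Step k Reg) : ℕ :=
  Finset.univ.sup fun r : Fin (2 ^ k) =>
    max (st.msgs.filter fun μ => μ.src = r ∧ μ.dst ≠ r).card
      (st.msgs.filter fun μ => μ.dst = r ∧ μ.src ≠ r).card

/-- A semiring algorithm on `M(2 ^ k)` for instances consisting of two `N × N` matrices.
The steps, their labels and the messages (sources, destinations) do not depend on the values of
the inputs: every such algorithm is static. -/
structure Algorithm (k N : ℕ) where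
  /-- Names of the registers of a PE. -/
  Reg : Type
  steps : List (Step k Reg)
  /-- The input entry, if any, that a register initially contains. -/
  input : Fin (2 ^ k) → Reg → Option (Entry N)
  /-- The PE and the register where an entry of the output matrix is produced. -/
  output : Fin N → Fin N → Fin (2 ^ k) × Reg

namespace Algorithm

variable {k N : ℕ}

/-- Initial memory if the inputs have the values `inst`; registers without input hold `0`. -/
def start (𝒜 : Algorithm k N) {S : Type} [Semiring S] (inst : Entry N → S) :
    Fin (2 ^ k) → 𝒜.Reg → S :=
  fun r d => (𝒜.input r d).elim 0 inst

/-- Final memory. -/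
noncomputable def final (𝒜 : Algorithm k N) {S : Type} [Semiring S] (inst : Entry N → S) :
    Fin (2 ^ k) → 𝒜.Reg → S :=
  𝒜.steps.foldl Step.exec (𝒜.start inst)

/-- The algorithm solves the matrix multiplication problem, over every semiring. -/
def Solves (𝒜 : Algorithm k N) : Prop :=
  ∀ (S : Type) [Semiring S] (A B : Matrix (Fin N) (Fin N) S) (i j : Fin N),
    𝒜.final (Entry.val A B) (𝒜.output i j).1 (𝒜.output i j).2 = (A * B) i j

/-- No entry of the input matrices is initially replicated. -/
def NoReplication (𝒜 : Algorithm k N) : Prop :=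
  ∀ (e : Entry N) (r r' : Fin (2 ^ k)) (d d' : 𝒜.Reg),
    𝒜.input r d = some e → 𝒜.input r' d' = some e → r = r' ∧ d = d'

/-- PE `r` computes the multiplicative term `A[i,l] * B[l,j]`, where `t = (i, l, j)`: it executes
a multiplication whose operands have the values `A[i,l]` and `B[l,j]`, as elements of the free
semiring on the input entries. -/
def Computes (𝒜 : Algorithm k N) (r : Fin (2 ^ k)) (t : Fin N × Fin N × Fin N) : Prop :=
  ∃ (before after : List (Step k 𝒜.Reg)) (st : Step k 𝒜.Reg)
    (code₁ code₂ : List (Instr 𝒜.Reg)) (d x y : 𝒜.Reg),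
    𝒜.steps = before ++ st :: after ∧
    st.code r = code₁ ++ Instr.mul d x y :: code₂ ∧
    runCode code₁ (before.foldl Step.exec (𝒜.start (FreeAlgebra.ι ℕ)) r) x =
      FreeAlgebra.ι ℕ (Entry.A t.1 t.2.1) ∧
    runCode code₁ (before.foldl Step.exec (𝒜.start (FreeAlgebra.ι ℕ)) r) y =
      FreeAlgebra.ι ℕ (Entry.B t.2.1 t.2.2)

/-- No PE computes more than `n ^ (3/2) / min {q, 11 ^ 3}` multiplicative terms, where `n = N ^ 2`
is the size of the matrices and `q = 2 ^ k` the number of PEs. -/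
def BalancedTerms (𝒜 : Algorithm k N) : Prop :=
  ∀ r : Fin (2 ^ k),
    ({t | 𝒜.Computes r t}.ncard : ℝ) ≤ (N : ℝ) ^ 3 / min ((2 : ℝ) ^ k) (11 ^ 3)

/-- The PE of `M(2 ^ j)` that carries out the operations of PE `r` of `M(2 ^ k)`. -/
def block {k j : ℕ} (hj : j ≤ k) (r : Fin (2 ^ k)) : Fin (2 ^ j) :=
  ⟨r.val / 2 ^ (k - j), by
    rw [Nat.div_lt_iff_lt_mul (by positivity), ← pow_add, Nat.add_sub_cancel' hj]
    exact r.isLt⟩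

open Classical in
/-- Folding of a step: PE `R` executes the code of the PEs in its block, on registers of its own
for each of them. -/
noncomputable def foldStep {k j : ℕ} (hj : j ≤ k) {Reg : Type} (st : Step k Reg) :
    Step j (Fin (2 ^ k) × Reg) where
  label := st.label
  code R := (List.finRange (2 ^ k)).flatMap fun r =>
    if block hj r = R then (st.code r).map (Instr.rename (Prod.mk r)) else []
  msgs := st.msgs.image fun μ =>
    ⟨block hj μ.src, block hj μ.dst, (μ.src, μ.srcReg), (μ.dst, μ.dstReg)⟩
  tagged := by
    intro μ hμ ν hν _ h
    obtain ⟨μ', hμ', rfl⟩ := Finset.mem_image.1 hμ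
    obtain ⟨ν', hν', rfl⟩ := Finset.mem_image.1 hν
    rw [st.tagged μ' hμ' ν' hν' (Prod.ext_iff.1 h).1 (Prod.ext_iff.1 h).2]
  cluster := by
    intro μ hμ
    obtain ⟨μ', hμ', rfl⟩ := Finset.mem_image.1 hμ
    have h := st.cluster μ' hμ'
    have e : k - j + (j - st.label) = (k - st.label) + (k - j + (j - st.label) - (k - st.label)) := by
      omega
    simp only [block, Nat.div_div_eq_div_mul, ← pow_add]
    rw [e, pow_add, ← Nat.div_div_eq_div_mul, ← Nat.div_div_eq_div_mul, h]

/-- Folding of an algorithm for `M(2 ^ k)` onto the smaller machine `M(2 ^ j)`. -/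
noncomputable def fold {j : ℕ} (𝒜 : Algorithm k N) (hj : j ≤ k) : Algorithm j N where
  Reg := Fin (2 ^ k) × 𝒜.Reg
  steps := 𝒜.steps.map (foldStep hj)
  input R d := if block hj d.1 = R then 𝒜.input d.1 d.2 else none
  output a b := (block hj (𝒜.output a b).1, 𝒜.output a b)

/-- The number `S^i` of `i`-supersteps. -/
def numSupersteps (𝒜 : Algorithm k N) (i : ℕ) : ℕ :=
  (𝒜.steps.filter fun st => st.label = i).length

/-- The cumulative degree `F^i` of the `i`-supersteps. -/
def cumDegree (𝒜 : Algorithm k N) (i : ℕ) : ℕ :=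
  ((𝒜.steps.filter fun st => st.label = i).map Step.degree).sum

/-- The communication complexity `H` on the evaluation model `M(2 ^ k, σ)`. -/
noncomputable def commComplexity (𝒜 : Algorithm k N) (σ : ℝ) : ℝ :=
  ∑ i ∈ Finset.range k, ((𝒜.cumDegree i : ℝ) + (𝒜.numSupersteps i : ℝ) * σ)

/-- `(α, p)`-wiseness, for `p = 2 ^ l`, of an algorithm specified on `M(2 ^ k)`, `1 < p ≤ 2 ^ k`. -/
def IsWise (𝒜 : Algorithm k N) (α : ℝ) {l : ℕ} (hl : l ≤ k) : Prop :=
  0 < α ∧ α ≤ 1 ∧ 1 ≤ l ∧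
    ∀ (j : ℕ) (_ : 1 ≤ j) (hj : j ≤ l),
      α * ((2 : ℝ) ^ l / 2 ^ j) * ∑ i ∈ Finset.range j, ((𝒜.fold hl).cumDegree i : ℝ) ≤
        ∑ i ∈ Finset.range j, ((𝒜.fold (hj.trans hl)).cumDegree i : ℝ)

/-- The class `𝒞` of static semiring algorithms for matrix multiplication on `2 ^ k` PEs that do
not initially replicate the inputs, have balanced multiplicative terms, and whose foldings all
share these properties. -/
def InClass (𝒜 : Algorithm k N) : Prop :=
  (𝒜.Solves ∧ 𝒜.NoReplication ∧ 𝒜.BalancedTerms) ∧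
    ∀ (j : ℕ) (_ : 1 ≤ j) (hj : j < k),
      (𝒜.fold hj.le).Solves ∧ (𝒜.fold hj.le).NoReplication ∧ (𝒜.fold hj.le).BalancedTerms

/-- `β`-optimality on `M(2 ^ k, σ)` with respect to the class `𝒞`. -/
def IsOptimal (𝒜 : Algorithm k N) (β σ : ℝ) : Prop :=
  𝒜.InClass ∧ ∀ ℬ : Algorithm k N, ℬ.InClass →
    𝒜.commComplexity σ ≤ 1 / β * ℬ.commComplexity σ

end Algorithm

/-- The convention `log x = max {1, log₂ x}`. -/
noncomputable def lg (x : ℝ) : ℝ := max 1 (Real.logb 2 x)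

/-! ### The recursive 8-way algorithm

It is specified on `M(n)`, where `n = 2 ^ (2 * m)`, for matrices of side `2 ^ m`.  We describe it
with the recursion unfolded.  At level `i` there are `8 ^ i` subproblems of side `2 ^ (m - i)`; the
one with coordinates `x y z < 2 ^ i` is the product of the block `(x, z)` of `A` and the block
`(z, y)` of `B`, and contributes to the block `(x, y)` of `C`.  Its eight subproblems
are those with coordinates `2 * x + h`, `2 * y + k`, `2 * z + l`, for `h k l < 2`. -/

namespace MM

/-- The number of levels of the recursion: `log n / 3`, rounded up. -/
def levels (m : ℕ) : ℕ := (2 * m + 2) / 3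

/-- The position, among the `8 ^ i` subproblems of level `i`, of the one with coordinates `x y z`:
the eight subproblems of a problem are consecutive, in the order of `(h, k, l)`. -/
def seg : ℕ → ℕ → ℕ → ℕ → ℕ
  | 0, _, _, _ => 0
  | i + 1, x, y, z => 8 * seg i (x / 2) (y / 2) (z / 2) + (4 * (x % 2) + 2 * (y % 2) + z % 2)

/-- The VP that holds, at level `i ≥ 1`, the entry `(a, b)` (in global coordinates) of one of the
three matrices of the subproblem number `g`.  The `4 ^ (m - i)` entries of the matrix are
listed in row-major order, and the concatenation of the lists of all subproblems is cut into pieces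
of length `2 ^ i`, one for each VP.  Thus, if `3 * i ≤ 2 * m`, they are evenly spread over the segment
of the `n / 8 ^ i` consecutive VPs that are assigned to the subproblem.  If `3 * i > 2 * m`, which
happens at most at the last level, where the segments to be split have two or four VPs, every VP is
assigned four or two consecutive subproblems. -/
def spread (m i g : ℕ) (a b : Fin (2 ^ m)) : Fin (2 ^ (2 * m)) :=
  Fin.ofNat _ ((g * 4 ^ (m - i) +
    (a.val % 2 ^ (m - i) * 2 ^ (m - i) + b.val % 2 ^ (m - i))) / 2 ^ i)

/-- An even distribution of a matrix among the `n` VPs: one entry each. -/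
abbrev Layout (m : ℕ) : Type := Fin (2 ^ m) × Fin (2 ^ m) ≃ Fin (2 ^ (2 * m))

/-- The index of the block of level `i` that contains the row or column `a`. -/
def blk {m : ℕ} (i : ℕ) (a : Fin (2 ^ m)) : ℕ := a.val / 2 ^ (m - i)

/-- The VP that holds `A[a,c]` for the subproblem of level `i` with second coordinate `y`. -/
def homeA {m : ℕ} (π : Layout m) (i y : ℕ) (a c : Fin (2 ^ m)) : Fin (2 ^ (2 * m)) :=
  if i = 0 then π (a, c) else spread m i (seg i (blk i a) y (blk i c)) a c

/-- The VP that holds `B[c,b]` for the subproblem of level `i` with first coordinate `x`. -/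
def homeB {m : ℕ} (π : Layout m) (i x : ℕ) (c b : Fin (2 ^ m)) : Fin (2 ^ (2 * m)) :=
  if i = 0 then π (c, b) else spread m i (seg i x (blk i b) (blk i c)) c b

/-- The VP responsible for the entry `(a, b)` of the product computed by the subproblem of level
`i` with third coordinate `z`. -/
def homeC {m : ℕ} (π : Layout m) (i z : ℕ) (a b : Fin (2 ^ m)) : Fin (2 ^ (2 * m)) :=
  if i = 0 then π (a, b) else spread m i (seg i (blk i a) (blk i b) z) a b

/-- Register names: the copies of the entries of `A` and `B` and the entries of the products for the
subproblems of level `i`, one auxiliary register, and registers for dummy messages. -/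
inductive Reg (m : ℕ) where
  | A (i y : ℕ) (a c : Fin (2 ^ m)) : Reg m
  | B (i x : ℕ) (c b : Fin (2 ^ m)) : Reg m
  | C (i z : ℕ) (a b : Fin (2 ^ m)) : Reg m
  | tmp : Reg m
  | dummy (t : ℕ) : Reg m

/-- Index set of families of messages: two matrix indices and a block index. -/
def triples (m i : ℕ) : Finset (Fin (2 ^ m) × Fin (2 ^ m) × ℕ) :=
  Finset.univ ×ˢ (Finset.univ ×ˢ Finset.range (2 ^ i))

open Classical in
/-- The dummy messages of a `3i`-superstep: `2 ^ i` from `VP_j` to `VP_(j + n / 2 ^ (3 i + 1))`, for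
`0 ≤ j < n / 2 ^ (3 i + 1)`. -/
noncomputable def dummies (m i : ℕ) : Finset (Message (2 * m) (Reg m)) :=
  (Finset.range (2 ^ (2 * m) / 2 ^ (3 * i + 1)) ×ˢ Finset.range (2 ^ i)).image fun w =>
    ⟨Fin.ofNat _ w.1, Fin.ofNat _ (w.1 + 2 ^ (2 * m) / 2 ^ (3 * i + 1)), .dummy w.2, .dummy w.2⟩

open Classical in
/-- Replication of the inputs: every entry of `A` and `B` held for a subproblem of level `i` is
sent to the two subproblems of level `i + 1` that need it. -/
noncomputable def distMsgs {m : ℕ} (πA πB : Layout m) (i : ℕ) :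
    Finset (Message (2 * m) (Reg m)) :=
  ((triples m (i + 1)).image fun w =>
      ⟨homeA πA i (w.2.2 / 2) w.1 w.2.1, homeA πA (i + 1) w.2.2 w.1 w.2.1,
        .A i (w.2.2 / 2) w.1 w.2.1, .A (i + 1) w.2.2 w.1 w.2.1⟩) ∪
    ((triples m (i + 1)).image fun w =>
      ⟨homeB πB i (w.2.2 / 2) w.1 w.2.1, homeB πB (i + 1) w.2.2 w.1 w.2.1,
        .B i (w.2.2 / 2) w.1 w.2.1, .B (i + 1) w.2.2 w.1 w.2.1⟩) ∪
    dummies m i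

open Classical in
/-- Collection of the products: every entry of the products of level `i + 1` is sent to
the VP responsible for the corresponding entry of the product of level `i`. -/
noncomputable def collMsgs {m : ℕ} (πC : Layout m) (i : ℕ) :
    Finset (Message (2 * m) (Reg m)) :=
  ((triples m (i + 1)).image fun w =>
      ⟨homeC πC (i + 1) w.2.2 w.1 w.2.1, homeC πC i (w.2.2 / 2) w.1 w.2.1,
        .C (i + 1) w.2.2 w.1 w.2.1, .C (i + 1) w.2.2 w.1 w.2.1⟩) ∪
    dummies m i

/-- The operations that produce the entry `(a, b)` of the product of the subproblem of level `i`
with third coordinate `z`: at the last level the classical algorithm, above it the sum of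
two collected values. -/
def entryCode {m : ℕ} (i z : ℕ) (a b : Fin (2 ^ m)) : List (Instr (Reg m)) :=
  if i = levels m then
    Instr.zero (.C i z a b) :: ((List.finRange (2 ^ m)).filter fun c => blk i c = z).flatMap fun c =>
      [.mul .tmp (.A i (blk i b) a c) (.B i (blk i a) c b),
        .add (.C i z a b) (.C i z a b) .tmp]
  else [.add (.C i z a b) (.C (i + 1) (2 * z) a b) (.C (i + 1) (2 * z + 1) a b)]

/-- The operations of VP `r` that produce all entries of products of level `i` that it is
responsible for. -/
def prodCode {m : ℕ} (πC : Layout m) (i : ℕ) (r : Fin (2 ^ (2 * m))) : List (Instr (Reg m)) :=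
  (List.range (2 ^ i)).flatMap fun z =>
    (List.finRange (2 ^ m)).flatMap fun a =>
      (List.finRange (2 ^ m)).flatMap fun b =>
        if homeC πC i z a b = r then entryCode i z a b else []

theorem seg_succ_div (i x y z : ℕ) : seg (i + 1) x y z / 8 = seg i (x / 2) (y / 2) (z / 2) := by
  simp only [seg]
  omega

theorem seg_lt (i x y z : ℕ) : seg i x y z < 8 ^ i := by
  induction i generalizing x y z with
  | zero => simp [seg]
  | succ i ih =>
    have := ih (x / 2) (y / 2) (z / 2)
    simp only [seg, pow_succ]
    omega

theorem offset_lt {m : ℕ} (i : ℕ) (a b : Fin (2 ^ m)) :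
    a.val % 2 ^ (m - i) * 2 ^ (m - i) + b.val % 2 ^ (m - i) < 4 ^ (m - i) := by
  have hs : 0 < 2 ^ (m - i) := by positivity
  have h1 := Nat.mod_lt a.val hs
  have h2 := Nat.mod_lt b.val hs
  have h4 : 4 ^ (m - i) = 2 ^ (m - i) * 2 ^ (m - i) := by
    rw [← mul_pow]
    norm_num
  rw [h4]
  nlinarith

theorem spread_val {m i g : ℕ} (hi : i ≤ m) (hg : g < 8 ^ i) (a b : Fin (2 ^ m)) :
    (spread m i g a b).val = (g * 4 ^ (m - i) +
      (a.val % 2 ^ (m - i) * 2 ^ (m - i) + b.val % 2 ^ (m - i))) / 2 ^ i := by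
  have ho := offset_lt i a b
  rw [spread, Fin.val_ofNat]
  apply Nat.mod_eq_of_lt
  rw [Nat.div_lt_iff_lt_mul (by positivity)]
  have e : 2 ^ (2 * m) * 2 ^ i = 8 ^ i * 4 ^ (m - i) := by
    rw [show (8 : ℕ) = 2 ^ 3 by norm_num, show (4 : ℕ) = 2 ^ 2 by norm_num, ← pow_mul, ← pow_mul,
      ← pow_add, ← pow_add]
    congr 1
    omega
  rw [e]
  nlinarith [Nat.mul_le_mul_right (4 ^ (m - i)) (Nat.succ_le_of_lt hg)]

/-- The entries of a subproblem of level `i` lie in its segment. -/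
theorem spread_div {m i g : ℕ} (hi : i ≤ m) (hi' : 3 * i ≤ 2 * m) (hg : g < 8 ^ i)
    (a b : Fin (2 ^ m)) : (spread m i g a b).val / 2 ^ (2 * m - 3 * i) = g := by
  have ho := offset_lt i a b
  rw [spread_val hi hg, Nat.div_div_eq_div_mul, ← pow_add]
  have e : 2 ^ (i + (2 * m - 3 * i)) = 4 ^ (m - i) := by
    rw [show (4 : ℕ) = 2 ^ 2 by norm_num, ← pow_mul]
    congr 1
    omega
  rw [e, add_comm, Nat.add_mul_div_right _ _ (by positivity), Nat.div_eq_of_lt ho, zero_add]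

/-- The entries of a subproblem of level `i + 1` lie in the segment of its parent. -/
theorem spread_succ_div {m i g : ℕ} (hi : i + 1 ≤ m) (hi' : 3 * i ≤ 2 * m) (hg : g < 8 ^ (i + 1))
    (a b : Fin (2 ^ m)) : (spread m (i + 1) g a b).val / 2 ^ (2 * m - 3 * i) = g / 8 := by
  have ho := offset_lt (i + 1) a b
  rw [spread_val hi hg, Nat.div_div_eq_div_mul, ← pow_add]
  have e : 2 ^ (i + 1 + (2 * m - 3 * i)) = 4 ^ (m - (i + 1)) * 8 := by
    rw [show (4 : ℕ) = 2 ^ 2 by norm_num, show (8 : ℕ) = 2 ^ 3 by norm_num, ← pow_mul, ← pow_add]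
    congr 1
    omega
  rw [e, ← Nat.div_div_eq_div_mul, add_comm, Nat.add_mul_div_right _ _ (by positivity),
    Nat.div_eq_of_lt ho, zero_add]

theorem blk_succ {m i : ℕ} (hi : i + 1 ≤ m) (a : Fin (2 ^ m)) : blk (i + 1) a / 2 = blk i a := by
  rw [blk, blk, Nat.div_div_eq_div_mul, ← pow_succ]
  congr 2
  omega

theorem level_le {m i : ℕ} (h : i < levels m) : i + 1 ≤ m ∧ 3 * i + 1 ≤ 2 * m := by
  unfold levels at h
  omega

theorem zero_cluster {m : ℕ} (r : Fin (2 ^ (2 * m))) : r.val / 2 ^ (2 * m - 3 * 0) = 0 :=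
  Nat.div_eq_of_lt (by simp)

theorem homeA_cluster {m i : ℕ} (h : i < levels m) (π : Layout m) (y : ℕ) (a c : Fin (2 ^ m)) :
    (homeA π i (y / 2) a c).val / 2 ^ (2 * m - 3 * i) =
      (homeA π (i + 1) y a c).val / 2 ^ (2 * m - 3 * i) := by
  obtain ⟨h1, h2⟩ := level_le h
  rcases Nat.eq_zero_or_pos i with rfl | hi
  · rw [zero_cluster, zero_cluster]
  · rw [homeA, homeA, if_neg hi.ne', if_neg (by omega), spread_div (by omega) (by omega) (seg_lt ..),
      spread_succ_div h1 (by omega) (seg_lt ..), seg_succ_div, blk_succ h1, blk_succ h1]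

theorem homeB_cluster {m i : ℕ} (h : i < levels m) (π : Layout m) (x : ℕ) (c b : Fin (2 ^ m)) :
    (homeB π i (x / 2) c b).val / 2 ^ (2 * m - 3 * i) =
      (homeB π (i + 1) x c b).val / 2 ^ (2 * m - 3 * i) := by
  obtain ⟨h1, h2⟩ := level_le h
  rcases Nat.eq_zero_or_pos i with rfl | hi
  · rw [zero_cluster, zero_cluster]
  · rw [homeB, homeB, if_neg hi.ne', if_neg (by omega), spread_div (by omega) (by omega) (seg_lt ..),
      spread_succ_div h1 (by omega) (seg_lt ..), seg_succ_div, blk_succ h1, blk_succ h1]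

theorem homeC_cluster {m i : ℕ} (h : i < levels m) (π : Layout m) (z : ℕ) (a b : Fin (2 ^ m)) :
    (homeC π i (z / 2) a b).val / 2 ^ (2 * m - 3 * i) =
      (homeC π (i + 1) z a b).val / 2 ^ (2 * m - 3 * i) := by
  obtain ⟨h1, h2⟩ := level_le h
  rcases Nat.eq_zero_or_pos i with rfl | hi
  · rw [zero_cluster, zero_cluster]
  · rw [homeC, homeC, if_neg hi.ne', if_neg (by omega), spread_div (by omega) (by omega) (seg_lt ..),
      spread_succ_div h1 (by omega) (seg_lt ..), seg_succ_div, blk_succ h1, blk_succ h1]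

theorem dummies_bound {m i j : ℕ} (h : 3 * i + 1 ≤ 2 * m)
    (hj : j < 2 ^ (2 * m) / 2 ^ (3 * i + 1)) :
    j < 2 ^ (2 * m) ∧ j + 2 ^ (2 * m) / 2 ^ (3 * i + 1) < 2 ^ (2 * m) ∧
      j < 2 ^ (2 * m - 3 * i) ∧ j + 2 ^ (2 * m) / 2 ^ (3 * i + 1) < 2 ^ (2 * m - 3 * i) := by
  rw [Nat.pow_div h (by norm_num)] at hj ⊢
  have e : 2 ^ (2 * m - 3 * i) = 2 * 2 ^ (2 * m - (3 * i + 1)) := by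
    rw [← pow_succ']
    congr 1
    omega
  have l : 2 ^ (2 * m - 3 * i) ≤ 2 ^ (2 * m) := Nat.pow_le_pow_right (by norm_num) (by omega)
  omega

open Classical in
theorem dummies_cluster {m i : ℕ} (h : 3 * i + 1 ≤ 2 * m) (μ : Message (2 * m) (Reg m))
    (hμ : μ ∈ dummies m i) :
    μ.src.val / 2 ^ (2 * m - 3 * i) = μ.dst.val / 2 ^ (2 * m - 3 * i) := by
  obtain ⟨w, hw, rfl⟩ := Finset.mem_image.1 hμ
  obtain ⟨h1, h2, h3, h4⟩ := dummies_bound h (Finset.mem_range.1 (Finset.mem_product.1 hw).1)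
  simp only [Fin.val_ofNat]
  rw [Nat.mod_eq_of_lt h1, Nat.mod_eq_of_lt h2, Nat.div_eq_of_lt h3, Nat.div_eq_of_lt h4]

open Classical in
theorem dummies_tagged {m i : ℕ} (h : 3 * i + 1 ≤ 2 * m) :
    ∀ μ ∈ dummies m i, ∀ ν ∈ dummies m i, μ.dst = ν.dst → μ.dstReg = ν.dstReg → μ = ν := by
  intro μ hμ ν hν hd hr
  obtain ⟨v, hv, rfl⟩ := Finset.mem_image.1 hμ
  obtain ⟨w, hw, rfl⟩ := Finset.mem_image.1 hν
  obtain ⟨-, h2, -, -⟩ := dummies_bound h (Finset.mem_range.1 (Finset.mem_product.1 hv).1)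
  obtain ⟨-, h2', -, -⟩ := dummies_bound h (Finset.mem_range.1 (Finset.mem_product.1 hw).1)
  have hd' := congrArg Fin.val hd
  simp only [Fin.val_ofNat] at hd'
  rw [Nat.mod_eq_of_lt h2, Nat.mod_eq_of_lt h2'] at hd'
  have e1 : v.1 = w.1 := by omega
  have e2 : v.2 = w.2 := by simpa using hr
  rw [show v = w from Prod.ext e1 e2]

open Classical in
theorem dummies_reg {m i : ℕ} (μ : Message (2 * m) (Reg m)) (hμ : μ ∈ dummies m i) :
    ∃ t, μ.dstReg = .dummy t := by
  obtain ⟨w, -, rfl⟩ := Finset.mem_image.1 hμ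
  exact ⟨w.2, rfl⟩

open Classical in
/-- The `3i`-superstep that replicates the inputs of the subproblems of level `i`. -/
noncomputable def distStep {m : ℕ} (πA πB : Layout m) (i : ℕ) (h : i < levels m) :
    Step (2 * m) (Reg m) where
  label := 3 * i
  code _ := []
  msgs := distMsgs πA πB i
  tagged := by
    intro μ hμ ν hν hd hr
    have hl := (level_le h).2
    simp only [distMsgs, Finset.mem_union, Finset.mem_image] at hμ hν
    rcases hμ with (⟨v, -, rfl⟩ | ⟨v, -, rfl⟩) | hμ <;>
      rcases hν with (⟨w, -, rfl⟩ | ⟨w, -, rfl⟩) | hν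
    · simp only [Reg.A.injEq] at hr
      obtain ⟨-, h1, h2, h3⟩ := hr
      rw [h1, h2, h3]
    · simp at hr
    · obtain ⟨t, ht⟩ := dummies_reg ν hν
      simp [ht] at hr
    · simp at hr
    · simp only [Reg.B.injEq] at hr
      obtain ⟨-, h1, h2, h3⟩ := hr
      rw [h1, h2, h3]
    · obtain ⟨t, ht⟩ := dummies_reg ν hν
      simp [ht] at hr
    · obtain ⟨t, ht⟩ := dummies_reg μ hμ
      simp [ht] at hr
    · obtain ⟨t, ht⟩ := dummies_reg μ hμ
      simp [ht] at hr
    · exact dummies_tagged hl μ hμ ν hν hd hr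
  cluster := by
    intro μ hμ
    simp only [distMsgs, Finset.mem_union, Finset.mem_image] at hμ
    rcases hμ with (⟨w, -, rfl⟩ | ⟨w, -, rfl⟩) | hμ
    · exact homeA_cluster h πA _ _ _
    · exact homeB_cluster h πB _ _ _
    · exact dummies_cluster (level_le h).2 μ hμ

open Classical in
/-- The `3i`-superstep in which the products of level `i + 1` are computed and collected for
level `i`. -/
noncomputable def collStep {m : ℕ} (πC : Layout m) (i : ℕ) (h : i < levels m) :
    Step (2 * m) (Reg m) where
  label := 3 * i
  code := prodCode πC (i + 1)
  msgs := collMsgs πC i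
  tagged := by
    intro μ hμ ν hν hd hr
    have hl := (level_le h).2
    simp only [collMsgs, Finset.mem_union, Finset.mem_image] at hμ hν
    rcases hμ with ⟨v, -, rfl⟩ | hμ <;> rcases hν with ⟨w, -, rfl⟩ | hν
    · simp only [Reg.C.injEq] at hr
      obtain ⟨-, h1, h2, h3⟩ := hr
      rw [h1, h2, h3]
    · obtain ⟨t, ht⟩ := dummies_reg ν hν
      simp [ht] at hr
    · obtain ⟨t, ht⟩ := dummies_reg μ hμ
      simp [ht] at hr
    · exact dummies_tagged hl μ hμ ν hν hd hr
  cluster := by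
    intro μ hμ
    simp only [collMsgs, Finset.mem_union, Finset.mem_image] at hμ
    rcases hμ with ⟨w, -, rfl⟩ | hμ
    · exact (homeC_cluster h πC _ _ _).symm
    · exact dummies_cluster (level_le h).2 μ hμ

/-- The last `0`-superstep, in which the output matrix is computed from the collected values. -/
noncomputable def lastStep {m : ℕ} (πC : Layout m) (h : 0 < levels m) :
    Step (2 * m) (Reg m) where
  label := 0
  code := prodCode πC 0
  msgs := dummies m 0
  tagged := dummies_tagged (level_le h).2
  cluster := dummies_cluster (level_le h).2

open Classical in
/-- The recursive 8-way matrix multiplication algorithm on `M(n)`, `n = 2 ^ (2 * m)`, for inputs `A`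
and `B` distributed according to `πA` and `πB` and the output distributed according to `πC`. -/
noncomputable def algorithm {m : ℕ} (hm : 1 ≤ m) (πA πB πC : Layout m) :
    Algorithm (2 * m) (2 ^ m) where
  Reg := Reg m
  steps :=
    (List.finRange (levels m)).map (fun i : Fin (levels m) => distStep πA πB i i.isLt) ++
      (List.finRange (levels m)).reverse.map (fun i : Fin (levels m) => collStep πC i i.isLt) ++
      [lastStep πC (by unfold levels; omega)]
  input
    | r, .A 0 0 a c => if πA (a, c) = r then some (.A a c) else none
    | r, .B 0 0 c b => if πB (c, b) = r then some (.B c b) else none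
    | _, _ => none
  output a b := (πC (a, b), .C 0 0 a b)

end MM

/-!
*Lower bound.* Assign each multiplicative term `A[i,k] * B[k,j]` to a processing element that
computes it. Running the algorithm over a free semiring, every operand that a PE uses and every
product it contributes to an entry of the output is either held there from the start (for the
output: at the end) or enters (leaves) the PE in a message, so the three projections of the set of
terms of a PE are at most its share of the matrices plus the number of its messages. No PE has more
than about half of the terms, so Loomis–Whitney forces the total degree to be `Ω(n / p ^ (2/3))`.

*Upper bound.* At level `i` of the recursion a PE sends and receives at most `5 * 2 ^ i` messages,
hence the folded superstep has degree at most `5 * 2 ^ i * n / p`. The sum over `3 * i < log p` is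
geometric and dominated by its last term, `n / p ^ (2/3)`. The dummy messages make the folded degree
at least `2 ^ i * n / p`, which gives wiseness.
-/

/-! ### Counting -/

section Counting

open Finset

/-- Two points of `T` over the same point of the third coordinate plane are determined by the first
projection of one and the second projection of the other. -/
theorem card_pairs_same_image_le {α β γ : Type*} [DecidableEq α] [DecidableEq β] [DecidableEq γ]
    (T : Finset (α × β × γ)) :
    #{x ∈ T ×ˢ T | (x.1.1, x.1.2.2) = (x.2.1, x.2.2.2)} ≤
      #(T.image fun t => (t.1, t.2.1)) * #(T.image fun t => (t.2.1, t.2.2)) := by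
  rw [← card_product]
  refine card_le_card_of_injOn (fun x => ((x.1.1, x.1.2.1), (x.2.2.1, x.2.2.2)))
    (fun x hx => ?_) ?_
  · have hx := mem_product.1 (mem_filter.1 hx).1
    exact mem_product.2 ⟨mem_image_of_mem (fun t => (t.1, t.2.1)) hx.1,
      mem_image_of_mem (fun t => (t.2.1, t.2.2)) hx.2⟩
  · rintro ⟨⟨a, b, c⟩, a', b', c'⟩ hx ⟨⟨d, e, f⟩, d', e', f'⟩ hy h
    simp only [coe_filter, mem_product, Set.mem_ofPred_eq, Prod.mk.injEq] at hx hy h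
    grind

/-- The discrete Loomis–Whitney inequality in dimension three. -/
theorem card_sq_le_card_image_mul_card_image_mul_card_image {α β γ : Type*} [DecidableEq α]
    [DecidableEq β] [DecidableEq γ] (T : Finset (α × β × γ)) :
    #T ^ 2 ≤ #(T.image fun t => (t.1, t.2.1)) * #(T.image fun t => (t.2.1, t.2.2)) *
      #(T.image fun t => (t.1, t.2.2)) := by
  set C := T.image fun t => (t.1, t.2.2)
  have maps_to : ∀ t ∈ T, (t.1, t.2.2) ∈ C := fun t ht => mem_image_of_mem _ ht
  have sum_sq : ∑ c ∈ C, #{t ∈ T | (t.1, t.2.2) = c} ^ 2 =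
      #{x ∈ T ×ˢ T | (x.1.1, x.1.2.2) = (x.2.1, x.2.2.2)} := by
    rw [card_eq_sum_card_fiberwise (f := fun x => (x.1.1, x.1.2.2)) (t := C)
      fun x hx => maps_to _ (mem_product.1 (mem_filter.1 hx).1).1]
    refine sum_congr rfl fun c _ => ?_
    rw [sq, ← card_product, ← filter_product, filter_filter]
    exact congrArg card (filter_congr fun x _ => by grind)
  calc #T ^ 2 = (∑ c ∈ C, #{t ∈ T | (t.1, t.2.2) = c}) ^ 2 := by
        rw [card_eq_sum_card_fiberwise maps_to]
    _ ≤ #C * ∑ c ∈ C, #{t ∈ T | (t.1, t.2.2) = c} ^ 2 := sq_sum_le_card_mul_sum_sq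
    _ ≤ #C * (#(T.image fun t => (t.1, t.2.1)) * #(T.image fun t => (t.2.1, t.2.2))) :=
        Nat.mul_le_mul_left _ (sum_sq.trans_le (card_pairs_same_image_le T))
    _ = _ := mul_comm _ _

theorem mul_mul_le_mean_pow_three {x y z : ℝ} (hx : 0 ≤ x) (hy : 0 ≤ y) (hz : 0 ≤ z) :
    x * y * z ≤ ((x + y + z) / 3) ^ 3 := by
  nlinarith [mul_nonneg hx (sq_nonneg (y - z)), mul_nonneg hy (sq_nonneg (x - z)),
    mul_nonneg hz (sq_nonneg (x - y)), mul_nonneg hx (sq_nonneg (x - z)),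
    mul_nonneg hx (sq_nonneg (x - y)), mul_nonneg hy (sq_nonneg (y - z)),
    mul_nonneg hy (sq_nonneg (y - x)), mul_nonneg hz (sq_nonneg (z - y)),
    mul_nonneg hz (sq_nonneg (z - x))]

theorem le_add_of_sq_le_pow_three {s t h p : ℝ} (hs : 0 ≤ s) (hh : 0 ≤ h) (hp : 0 < p)
    (ht : t ≤ 1 / 2) (hst : t ^ 2 ≤ (s + h) ^ 3) (hhp : h ^ 3 * p ^ 2 ≤ (1 / 50) ^ 3) :
    t ≤ 91 / 100 * s + 8 / 100 / p := by
  rcases le_total (7 * h) s with hle | hle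
  · -- The surplus is negligible, and `t ≤ 1 / 2` turns `t ^ 2` into `2 * t ^ 3`.
    have add_le : (s + h) ^ 3 ≤ (8 / 7 * s) ^ 3 := pow_le_pow_left₀ (by positivity) (by linarith) 3
    have pow_three_le : t ^ 3 ≤ (91 / 100 * s) ^ 3 := by
      nlinarith [mul_nonneg (sub_nonneg.2 ht) (sq_nonneg t), pow_nonneg hs 3]
    have : t ≤ 91 / 100 * s := le_of_pow_le_pow_left₀ three_ne_zero (by positivity) pow_three_le
    linarith [show 0 ≤ 8 / 100 / p by positivity]
  · have add_le : (s + h) ^ 3 ≤ (8 * h) ^ 3 := pow_le_pow_left₀ (by positivity) (by linarith) 3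
    have sq_le : t ^ 2 ≤ (8 / 100 / p) ^ 2 := by
      rw [div_pow, le_div_iff₀ (by positivity)]
      nlinarith [mul_le_mul_of_nonneg_right (hst.trans add_le) (sq_nonneg p)]
    linarith [le_of_sq_le_sq sq_le (by positivity)]

/-- The share `t r` of the work of `r` is bounded by the volume that its share `s r` of the data and
the surplus `h`, which it gets from others, can span. -/
theorem le_surplus_of_sq_le_pow_three {ι : Type*} [Fintype ι] {s t : ι → ℝ} {h : ℝ} (hh : 0 ≤ h)
    (hs : ∀ r, 0 ≤ s r) (ht : ∀ r, t r ≤ 1 / 2) (hst : ∀ r, t r ^ 2 ≤ (s r + h) ^ 3)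
    (sum_s : ∑ r, s r ≤ 1) (sum_t : 1 ≤ ∑ r, t r) :
    (1 / 50) ^ 3 ≤ h ^ 3 * (Fintype.card ι : ℝ) ^ 2 := by
  by_contra! hlt
  have : Nonempty ι := by
    by_contra hι
    rw [not_nonempty_iff] at hι
    norm_num at sum_t
  have hp : (0 : ℝ) < Fintype.card ι := Nat.cast_pos.2 Fintype.card_pos
  have : ∑ r, t r ≤ 91 / 100 * ∑ r, s r + 8 / 100 := by
    calc ∑ r, t r ≤ ∑ r, (91 / 100 * s r + 8 / 100 / (Fintype.card ι : ℝ)) :=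
          sum_le_sum fun r _ => le_add_of_sq_le_pow_three (hs r) hh hp (ht r) (hst r) hlt.le
      _ = 91 / 100 * ∑ r, s r + 8 / 100 := by
          rw [sum_add_distrib, ← mul_sum, sum_const, card_univ, nsmul_eq_mul,
            mul_div_cancel₀ _ hp.ne']
  linarith

theorem div_pow_three_sq_le {n T a b c d : ℝ} (ha : 0 ≤ a) (hb : 0 ≤ b) (hc : 0 ≤ c) (hd : 0 ≤ d)
    (hn : 0 < n) (h : T ^ 2 ≤ (a + d) * (b + d) * (c + d)) :
    (T / n ^ 3) ^ 2 ≤ ((a + b + c) / (3 * n ^ 2) + d / n ^ 2) ^ 3 := by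
  have hT : T ^ 2 ≤ ((a + d + (b + d) + (c + d)) / 3) ^ 3 :=
    h.trans (mul_mul_le_mean_pow_three (by positivity) (by positivity) (by positivity))
  calc (T / n ^ 3) ^ 2 = T ^ 2 / (n ^ 2) ^ 3 := by rw [div_pow]; ring
    _ ≤ ((a + d + (b + d) + (c + d)) / 3) ^ 3 / (n ^ 2) ^ 3 := by gcongr
    _ = ((a + b + c) / (3 * n ^ 2) + d / n ^ 2) ^ 3 := by
        rw [← div_pow]
        congr 1
        field_simp
        ring

/-- Here `f t` is the owner of the point `t` of a cube, who initially holds `a r`, `b r` and `c r`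
points of the three faces and gets at most `d` more on each. -/
theorem le_surplus_of_card_image_le {α ι : Type*} [Fintype α] [DecidableEq α] [Fintype ι]
    [DecidableEq ι] (f : α × α × α → ι) {a b c : ι → ℕ} {d : ℕ}
    (ha : ∀ r, #(image (fun t => (t.1, t.2.1)) {t | f t = r}) ≤ a r + d)
    (hb : ∀ r, #(image (fun t => (t.2.1, t.2.2)) {t | f t = r}) ≤ b r + d)
    (hc : ∀ r, #(image (fun t => (t.1, t.2.2)) {t | f t = r}) ≤ c r + d)
    (sum_a : ∑ r, a r ≤ Fintype.card α ^ 2) (sum_b : ∑ r, b r ≤ Fintype.card α ^ 2)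
    (sum_c : ∑ r, c r ≤ Fintype.card α ^ 2)
    (hf : ∀ r, (#{t | f t = r} : ℝ) ≤ (Fintype.card α : ℝ) ^ 3 / 2) :
    ((Fintype.card α : ℝ) ^ 2 / 50) ^ 3 ≤ (d : ℝ) ^ 3 * (Fintype.card ι : ℝ) ^ 2 := by
  rcases (Fintype.card α).eq_zero_or_pos with hα | hα
  · rw [hα]
    norm_num
    positivity
  set n := (Fintype.card α : ℝ) with hn
  have hn0 : 0 < n := Nat.cast_pos.2 hα
  have loomis_whitney : ∀ r, (#{t | f t = r} : ℝ) ^ 2 ≤ (a r + d) * (b r + d) * (c r + d) := by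
    intro r
    exact_mod_cast (card_sq_le_card_image_mul_card_image_mul_card_image _).trans
      (Nat.mul_le_mul (Nat.mul_le_mul (ha r) (hb r)) (hc r))
  have sum_fibers : ∑ r, (#{t | f t = r} : ℝ) = n ^ 3 := by
    rw [← Nat.cast_sum, ← card_eq_sum_card_fiberwise fun _ _ => mem_univ _, card_univ]
    simp only [Fintype.card_prod, Nat.cast_mul, ← hn]
    ring
  have cast_sum_le : ∀ {a : ι → ℕ}, ∑ r, a r ≤ Fintype.card α ^ 2 → ∑ r, (a r : ℝ) ≤ n ^ 2 :=
    fun h => by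
      rw [hn]
      exact_mod_cast h
  have surplus := le_surplus_of_sq_le_pow_three (ι := ι) (h := d / n ^ 2)
    (s := fun r => ((a r : ℝ) + b r + c r) / (3 * n ^ 2)) (t := fun r => #{t | f t = r} / n ^ 3)
    (by positivity) (fun r => by positivity)
    (fun r => by rw [div_le_iff₀ (by positivity)]; linarith [hf r])
    (fun r => div_pow_three_sq_le (by positivity) (by positivity) (by positivity) (by positivity)
      hn0 (loomis_whitney r))
    (by
      rw [← sum_div, div_le_one (by positivity), sum_add_distrib, sum_add_distrib]
      linarith [cast_sum_le sum_a, cast_sum_le sum_b, cast_sum_le sum_c])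
    (by rw [← sum_div, sum_fibers, div_self (by positivity)])
  calc (n ^ 2 / 50) ^ 3 = (1 / 50) ^ 3 * (n ^ 2) ^ 3 := by ring
    _ ≤ (d / n ^ 2) ^ 3 * (Fintype.card ι : ℝ) ^ 2 * (n ^ 2) ^ 3 := by gcongr
    _ = (d : ℝ) ^ 3 * (Fintype.card ι : ℝ) ^ 2 := by field_simp

theorem sum_card_filter_le {ι α : Type*} [Fintype ι] [Fintype α] (R : ι → α → Prop)
    [∀ r, DecidablePred (R r)] (hR : ∀ a r r', R r a → R r' a → r = r') :
    ∑ r, #{a | R r a} ≤ Fintype.card α := by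
  classical
  rw [← card_biUnion]
  · exact card_le_univ _
  · intro r _ r' _ hne
    rw [Function.onFun, disjoint_left]
    intro a ha ha'
    exact hne (hR a r r' (mem_filter.1 ha).2 (mem_filter.1 ha').2)

theorem card_le_card_add_card_of_forall_mem_or {α β : Type*} {s u : Finset α} {t : Finset β}
    (R : α → β → Prop) (h : ∀ a ∈ s, a ∈ u ∨ ∃ b ∈ t, R a b)
    (hR : ∀ a a' b, R a b → R a' b → a = a') : #s ≤ #u + #t := by
  classical
  have : #(s \ u) ≤ #t := by
    refine card_le_card_of_forall_subsingleton R (fun a ha => ?_)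
      (fun b _ a ha a' ha' => hR a a' b ha.2 ha'.2)
    rw [mem_sdiff] at ha
    exact (h a ha.1).resolve_left ha.2
  have := card_le_card_sdiff_add_card (s := s) (t := u)
  lia

theorem add_mul_inj_of_lt {q g g' o o' : ℕ} (ho : o < q) (ho' : o' < q)
    (h : g * q + o = g' * q + o') : g = g' ∧ o = o' := by
  have hq : 0 < q := by lia
  have hg := congrArg (· / q) h
  have ho := congrArg (· % q) h
  simp only [mul_comm _ q, Nat.mul_add_div hq, Nat.mul_add_mod, Nat.div_eq_of_lt, add_zero,
    Nat.mod_eq_of_lt, *] at hg ho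
  exact ⟨hg, ho⟩

end Counting

/-! ### Powers with exponent `2 / 3` -/

section Powers

theorem rpow_two_thirds_pow_three {p : ℝ} (hp : 0 ≤ p) : (p ^ (2 / 3 : ℝ)) ^ 3 = p ^ 2 := by
  rw [← Real.rpow_natCast, ← Real.rpow_mul hp, ← Real.rpow_natCast]
  norm_num

theorem div_rpow_two_thirds_le {x d p : ℝ} (hd : 0 ≤ d) (hp : 0 < p) (h : x ^ 3 ≤ d ^ 3 * p ^ 2) :
    x / p ^ (2 / 3 : ℝ) ≤ d := by
  rw [← rpow_two_thirds_pow_three hp.le, ← mul_pow] at h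
  rw [div_le_iff₀ (by positivity)]
  exact le_of_pow_le_pow_left₀ three_ne_zero (by positivity) h

theorem two_pow_mul_rpow_two_thirds_le (k : ℕ) :
    (2 : ℝ) ^ ((k + 2) / 3) * ((2 : ℝ) ^ k) ^ (2 / 3 : ℝ) ≤ 2 * 2 ^ k := by
  refine le_of_pow_le_pow_left₀ three_ne_zero (by positivity) ?_
  rw [mul_pow, rpow_two_thirds_pow_three (by positivity), ← pow_succ']
  simp only [← pow_mul, ← pow_add]
  exact pow_le_pow_right₀ one_le_two (by lia)

theorem lg_two_pow {k : ℕ} (hk : 1 ≤ k) : lg ((2 : ℝ) ^ k) = k := by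
  rw [lg, ← Real.rpow_natCast, Real.logb_rpow two_pos (by norm_num)]
  exact max_eq_right (by exact_mod_cast hk)

end Powers

/-! ### Lists -/

section Lists

theorem exists_of_flatMap_eq_append_cons {α β : Type*} {f : α → List β} {l : List α}
    {c₁ c₂ : List β} {b : β} (h : l.flatMap f = c₁ ++ b :: c₂) :
    ∃ l₁ a l₂ e₁ e₂, l = l₁ ++ a :: l₂ ∧ f a = e₁ ++ b :: e₂ ∧ c₁ = l₁.flatMap f ++ e₁ := by
  induction l generalizing c₁ with
  | nil => simp at h
  | cons a l ih =>
    rw [List.flatMap_cons] at h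
    rcases List.append_eq_append_iff.1 h with ⟨e, rfl, hl⟩ | ⟨_ | ⟨b', e⟩, ha, hl⟩
    · obtain ⟨l₁, a', l₂, e₁, e₂, rfl, ha', rfl⟩ := ih hl
      exact ⟨a :: l₁, a', l₂, e₁, e₂, rfl, ha', by simp⟩
    · obtain ⟨l₁, a', l₂, e₁, e₂, rfl, ha', hnil⟩ := ih (c₁ := []) hl.symm
      refine ⟨a :: l₁, a', l₂, e₁, e₂, rfl, ha', ?_⟩
      rw [List.flatMap_cons, List.append_assoc, ← hnil, ha]
      simp
    · obtain ⟨rfl, rfl⟩ := List.cons.inj hl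
      exact ⟨[], a, l, c₁, e, rfl, ha, by simp⟩

theorem foldl_finRange_induction {α : Type*} (P : ℕ → α → Prop) {n : ℕ} (f : α → Fin n → α)
    {x : α} (zero : P 0 x) (succ : ∀ (i : Fin n) x, P i x → P (i + 1) (f x i)) :
    P n ((List.finRange n).foldl f x) := by
  induction n generalizing P x with
  | zero => simpa using zero
  | succ n ih =>
    rw [List.finRange_succ, List.foldl_cons, List.foldl_map]
    exact ih (fun i => P (i + 1)) (fun x i => f x i.succ) (succ 0 x zero)
      fun i x hx => succ i.succ x hx

theorem foldl_finRange_reverse_induction {α : Type*} (P : ℕ → α → Prop) {n : ℕ}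
    (f : α → Fin n → α) {x : α} (last : P n x)
    (pred : ∀ (i : Fin n) x, P (i + 1) x → P i (f x i)) :
    P 0 ((List.finRange n).reverse.foldl f x) := by
  induction n generalizing P x with
  | zero => simpa using last
  | succ n ih =>
    rw [List.finRange_succ, List.reverse_cons, List.foldl_append, List.foldl_cons, List.foldl_nil,
      ← List.map_reverse, List.foldl_map]
    exact pred 0 _ (ih (fun i => P (i + 1)) (fun x i => f x i.succ) last
      fun i x hx => pred i.succ x hx)

theorem sum_map_filter_eq_sum_map_ite {α M : Type*} [AddCommMonoid M] (l : List α) (p : α → Prop)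
    [DecidablePred p] (f : α → M) :
    ((l.filter fun a => p a).map f).sum = (l.map fun a => if p a then f a else 0).sum := by
  rw [List.sum_map_ite]
  simp

theorem sum_range_sum_map_filter_eq {α M : Type*} [AddCommMonoid M] (l : List α) (key : α → ℕ)
    (f : α → M) (n : ℕ) :
    ∑ i ∈ Finset.range n, ((l.filter fun a => key a = i).map f).sum =
      ((l.filter fun a => key a < n).map f).sum := by
  simp only [sum_map_filter_eq_sum_map_ite]
  induction l with
  | nil => simp
  | cons a l ih =>
    simp only [List.map_cons, List.sum_cons, Finset.sum_add_distrib, ih, Finset.sum_ite_eq,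
      Finset.mem_range]

end Lists

/-! ### Execution and folding -/

section Execution

variable {Reg S : Type} [Semiring S]

theorem runCode_append (c₁ c₂ : List (Instr Reg)) (mem : Reg → S) :
    runCode (c₁ ++ c₂) mem = runCode c₂ (runCode c₁ mem) :=
  List.foldl_append

theorem runCode_cons (I : Instr Reg) (c : List (Instr Reg)) (mem : Reg → S) :
    runCode (I :: c) mem = runCode c (I.exec mem) :=
  rfl

@[simp]
theorem runCode_nil (mem : Reg → S) : runCode [] mem = mem :=
  rfl

variable {ι : Type}

theorem Instr.eq_mul_of_rename_eq_mul {Reg' : Type} {f : Reg → Reg'} {I : Instr Reg}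
    {d' x' y' : Reg'} (h : I.rename f = .mul d' x' y') :
    ∃ d x y, I = .mul d x y ∧ f d = d' ∧ f x = x' ∧ f y = y' := by
  cases I with
  | mul d x y =>
    obtain ⟨hd, hx, hy⟩ := Instr.mul.inj h
    exact ⟨d, x, y, rfl, hd, hx, hy⟩
  | zero _ => cases h
  | one _ => cases h
  | add _ _ _ => cases h

theorem runCode_rename_self (r : ι) (code : List (Instr Reg)) (M : ι × Reg → S) (d : Reg) :
    runCode (code.map (Instr.rename (Prod.mk r))) M (r, d) =
      runCode code (fun e => M (r, e)) d := by
  induction code generalizing M with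
  | nil => rfl
  | cons I c ih =>
    rw [List.map_cons, runCode_cons, runCode_cons, ih]
    congr 1
    ext e
    cases I <;> simp only [Instr.rename, Instr.exec, Function.update_apply] <;> split_ifs <;>
      simp_all

theorem runCode_rename_of_ne {r r' : ι} (hr : r' ≠ r) (code : List (Instr Reg)) (M : ι × Reg → S)
    (d : Reg) : runCode (code.map (Instr.rename (Prod.mk r))) M (r', d) = M (r', d) := by
  induction code generalizing M with
  | nil => rfl
  | cons I c ih =>
    rw [List.map_cons, runCode_cons, ih]
    cases I <;> simp [Instr.rename, Instr.exec, hr]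

theorem runCode_flatMap_rename_of_notMem (p : ι → Prop) [DecidablePred p]
    (code : ι → List (Instr Reg)) {l : List ι} (M : ι × Reg → S) {r : ι} (hr : r ∉ l) (d : Reg) :
    runCode (l.flatMap fun r => if p r then (code r).map (Instr.rename (Prod.mk r)) else []) M
      (r, d) = M (r, d) := by
  induction l generalizing M with
  | nil => rfl
  | cons a l ih =>
    simp only [List.mem_cons, not_or] at hr
    rw [List.flatMap_cons, runCode_append, ih _ hr.2]
    split_ifs
    · exact runCode_rename_of_ne hr.1 _ _ _
    · rfl

theorem runCode_flatMap_rename_of_mem (p : ι → Prop) [DecidablePred p]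
    (code : ι → List (Instr Reg)) {l : List ι} (hl : l.Nodup) (M : ι × Reg → S) {r : ι}
    (hr : r ∈ l) (hp : p r) (d : Reg) :
    runCode (l.flatMap fun r => if p r then (code r).map (Instr.rename (Prod.mk r)) else []) M
      (r, d) = runCode (code r) (fun e => M (r, e)) d := by
  obtain ⟨l₁, l₂, rfl⟩ := List.append_of_mem hr
  have hr₁ : r ∉ l₁ := fun h => (List.nodup_append.1 hl).2.2 r h r (by simp) rfl
  have hr₂ : r ∉ l₂ := (List.nodup_cons.1 (List.nodup_append.1 hl).2.1).1
  rw [List.flatMap_append, List.flatMap_cons, runCode_append, runCode_append,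
    runCode_flatMap_rename_of_notMem p code _ hr₂, if_pos hp, runCode_rename_self]
  congr 1
  ext e
  exact runCode_flatMap_rename_of_notMem p code _ hr₁ e

namespace Step

variable {k : ℕ} (mem : Fin (2 ^ k) → Reg → S) (st : Step k Reg)

theorem exec_of_mem {μ : Message k Reg} (hμ : μ ∈ st.msgs) :
    Step.exec mem st μ.dst μ.dstReg = runCode (st.code μ.src) (mem μ.src) μ.srcReg := by
  have h : ∃ ν ∈ st.msgs, ν.dst = μ.dst ∧ ν.dstReg = μ.dstReg := ⟨μ, hμ, rfl, rfl⟩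
  have choose_eq : h.choose = μ :=
    st.tagged _ h.choose_spec.1 _ hμ h.choose_spec.2.1 h.choose_spec.2.2
  simp only [Step.exec]
  rw [dif_pos h, choose_eq]

theorem exec_of_forall_ne {r : Fin (2 ^ k)} {d : Reg}
    (h : ∀ μ ∈ st.msgs, μ.dst = r → μ.dstReg ≠ d) :
    Step.exec mem st r d = runCode (st.code r) (mem r) d := by
  simp only [Step.exec]
  rw [dif_neg]
  rintro ⟨μ, hμ, hr, hd⟩
  exact h μ hμ hr hd

theorem exec_cases (r : Fin (2 ^ k)) (d : Reg) :
    (∃ μ ∈ st.msgs, μ.dst = r ∧ μ.dstReg = d ∧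
      Step.exec mem st r d = runCode (st.code μ.src) (mem μ.src) μ.srcReg) ∨
    (∀ μ ∈ st.msgs, μ.dst = r → μ.dstReg ≠ d) ∧
      Step.exec mem st r d = runCode (st.code r) (mem r) d := by
  by_cases h : ∃ μ ∈ st.msgs, μ.dst = r ∧ μ.dstReg = d
  · obtain ⟨μ, hμ, rfl, rfl⟩ := h
    exact .inl ⟨μ, hμ, rfl, rfl, exec_of_mem mem st hμ⟩
  · have h : ∀ μ ∈ st.msgs, μ.dst = r → μ.dstReg ≠ d := fun μ hμ hr hd => h ⟨μ, hμ, hr, hd⟩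
    exact .inr ⟨h, exec_of_forall_ne mem st h⟩

end Step

end Execution

namespace Algorithm

section Folding

variable {k N : ℕ} {j : ℕ} {hj : j ≤ k} {Reg S : Type} [Semiring S]

/-- The memory `M` of the folded machine contains the memory `mem` of the original one: PE
`block hj r` holds the registers of PE `r` as its registers `(r, d)`. -/
def Simulates (hj : j ≤ k) (M : Fin (2 ^ j) → Fin (2 ^ k) × Reg → S)
    (mem : Fin (2 ^ k) → Reg → S) : Prop :=
  ∀ r d, M (block hj r) (r, d) = mem r d

theorem Simulates.code {M : Fin (2 ^ j) → Fin (2 ^ k) × Reg → S} {mem : Fin (2 ^ k) → Reg → S}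
    (h : Simulates hj M mem) (st : Step k Reg) (r : Fin (2 ^ k)) (d : Reg) :
    runCode ((foldStep hj st).code (block hj r)) (M (block hj r)) (r, d) =
      runCode (st.code r) (mem r) d := by
  refine (runCode_flatMap_rename_of_mem (fun r' => block hj r' = block hj r) st.code
    (List.nodup_finRange (2 ^ k)) (M (block hj r)) (List.mem_finRange r) rfl d).trans ?_
  congr 1
  ext e
  exact h r e

theorem Simulates.exec {M : Fin (2 ^ j) → Fin (2 ^ k) × Reg → S} {mem : Fin (2 ^ k) → Reg → S}
    (h : Simulates hj M mem) (st : Step k Reg) :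
    Simulates hj (Step.exec M (foldStep hj st)) (Step.exec mem st) := by
  classical
  intro r d
  rcases Step.exec_cases mem st r d with ⟨μ, hμ, rfl, rfl, hexec⟩ | ⟨hr, hexec⟩
  · rw [hexec, ← h.code st]
    exact Step.exec_of_mem M (foldStep hj st) (Finset.mem_image_of_mem _ hμ)
  · rw [hexec, ← h.code st]
    refine Step.exec_of_forall_ne M (foldStep hj st) fun μ hμ _ hd => ?_
    obtain ⟨ν, hν, rfl⟩ := Finset.mem_image.1 hμ
    exact hr ν hν (congrArg Prod.fst hd) (congrArg Prod.snd hd)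

theorem Simulates.foldl (l : List (Step k Reg)) {M : Fin (2 ^ j) → Fin (2 ^ k) × Reg → S}
    {mem : Fin (2 ^ k) → Reg → S} (h : Simulates hj M mem) :
    Simulates hj ((l.map (foldStep hj)).foldl Step.exec M) (l.foldl Step.exec mem) := by
  induction l generalizing M mem with
  | nil => exact h
  | cons st _ ih => exact ih (h.exec st)

theorem simulates_start (𝒜 : Algorithm k N) (hj : j ≤ k) (inst : Entry N → S) :
    Simulates hj ((𝒜.fold hj).start inst) (𝒜.start inst) := by
  intro r d
  simp [start, fold]

theorem Solves.fold {𝒜 : Algorithm k N} (h : 𝒜.Solves) (hj : j ≤ k) : (𝒜.fold hj).Solves := by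
  intro S _ A B a b
  rw [← h S A B a b]
  exact (simulates_start 𝒜 hj _).foldl 𝒜.steps _ _

theorem NoReplication.fold {𝒜 : Algorithm k N} (h : 𝒜.NoReplication) (hj : j ≤ k) :
    (𝒜.fold hj).NoReplication := by
  rintro e R R' ⟨r, d⟩ ⟨r', d'⟩ h₁ h₂
  simp only [Algorithm.fold] at h₁ h₂
  split_ifs at h₁ with hR
  split_ifs at h₂ with hR'
  obtain ⟨rfl, rfl⟩ := h e r r' d d' h₁ h₂
  exact ⟨hR.symm.trans hR', rfl⟩

theorem exists_of_foldStep_code_eq {st : Step k Reg} {R : Fin (2 ^ j)}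
    {code₁ code₂ : List (Instr (Fin (2 ^ k) × Reg))} {J : Instr (Fin (2 ^ k) × Reg)}
    (h : (foldStep hj st).code R = code₁ ++ J :: code₂) :
    ∃ r c₁ I c₂, block hj r = R ∧ st.code r = c₁ ++ I :: c₂ ∧ I.rename (Prod.mk r) = J ∧
      ∀ (S : Type) [Semiring S] (M : Fin (2 ^ k) × Reg → S) (d : Reg),
        runCode code₁ M (r, d) = runCode c₁ (fun e => M (r, e)) d := by
  classical
  obtain ⟨l₁, r, l₂, e₁, e₂, hl, he, rfl⟩ := exists_of_flatMap_eq_append_cons h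
  have hr₁ : r ∉ l₁ := by
    have nodup := List.nodup_finRange (2 ^ k)
    rw [hl] at nodup
    exact fun h => (List.nodup_append.1 nodup).2.2 r h r (by simp) rfl
  split_ifs at he with hr
  · obtain ⟨c₁, c, hc, rfl, hIc⟩ := List.map_eq_append_iff.1 he
    obtain ⟨I, c₂, rfl, hI, rfl⟩ := List.map_eq_cons_iff.1 hIc
    refine ⟨r, c₁, I, c₂, hr, hc, hI, fun S _ M d => ?_⟩
    rw [runCode_append, runCode_rename_self]
    congr 1
    ext e
    exact runCode_flatMap_rename_of_notMem _ _ _ hr₁ e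
  · simp at he

theorem Computes.of_fold {𝒜 : Algorithm k N} {R : Fin (2 ^ j)} {t : Fin N × Fin N × Fin N}
    (h : (𝒜.fold hj).Computes R t) : ∃ r, block hj r = R ∧ 𝒜.Computes r t := by
  obtain ⟨before, after, st, code₁, code₂, d', x', y', hsteps, hcode, hx, hy⟩ := h
  obtain ⟨b, l, hbl, rfl, hl⟩ := List.map_eq_append_iff.1 hsteps
  obtain ⟨st, a, rfl, rfl, rfl⟩ := List.map_eq_cons_iff.1 hl
  obtain ⟨r, c₁, I, c₂, rfl, hc, hI, hrun⟩ := exists_of_foldStep_code_eq hcode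
  obtain ⟨d, x, y, rfl, rfl, rfl, rfl⟩ := Instr.eq_mul_of_rename_eq_mul hI
  have sim : (fun e => (b.map (foldStep hj)).foldl Step.exec
      ((𝒜.fold hj).start (FreeAlgebra.ι ℕ)) (block hj r) (r, e)) =
      b.foldl Step.exec (𝒜.start (FreeAlgebra.ι ℕ)) r :=
    funext fun e => (simulates_start 𝒜 hj _).foldl b r e
  refine ⟨r, rfl, b, a, st, c₁, c₂, d, x, y, hbl, hc, ?_, ?_⟩
  · rw [← hx, ← sim]
    exact (hrun _ _ _).symm
  · rw [← hy, ← sim]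
    exact (hrun _ _ _).symm

open Finset in
theorem card_block_eq_le (hj : j ≤ k) (R : Fin (2 ^ j)) :
    #{r : Fin (2 ^ k) | block hj r = R} ≤ 2 ^ (k - j) := by
  rw [← card_range (2 ^ (k - j))]
  refine card_le_card_of_injOn (fun r => r.val % 2 ^ (k - j)) (fun r _ => ?_) ?_
  · exact mem_coe.2 (mem_range.2 (Nat.mod_lt _ (by positivity)))
  · intro r hr r' hr' h
    have hdiv : r.val / 2 ^ (k - j) = r'.val / 2 ^ (k - j) :=
      congrArg Fin.val ((mem_filter.1 hr).2.trans (mem_filter.1 hr').2.symm)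
    apply Fin.ext
    rw [← Nat.div_add_mod r.val (2 ^ (k - j)), hdiv, show r.val % _ = r'.val % _ from h,
      Nat.div_add_mod]

/-- No PE computes more than its share `N ^ 3 / 2 ^ k` of the multiplicative terms. In contrast to
`BalancedTerms`, this is inherited by all foldings. -/
def EvenTerms (𝒜 : Algorithm k N) : Prop :=
  ∀ r : Fin (2 ^ k), {t | 𝒜.Computes r t}.ncard * 2 ^ k ≤ N ^ 3

open Finset in
theorem EvenTerms.fold {𝒜 : Algorithm k N} (h : 𝒜.EvenTerms) (hj : j ≤ k) :
    (𝒜.fold hj).EvenTerms := by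
  intro R
  have subset : {t | (𝒜.fold hj).Computes R t} ⊆
      ⋃ r ∈ ({r | block hj r = R} : Finset (Fin (2 ^ k))), {t | 𝒜.Computes r t} := by
    intro t ht
    obtain ⟨r, hr, hc⟩ := Computes.of_fold ht
    exact Set.mem_biUnion (mem_coe.2 (mem_filter.2 ⟨mem_univ r, hr⟩)) hc
  have ncard_le : {t | (𝒜.fold hj).Computes R t}.ncard ≤
      ∑ r : Fin (2 ^ k) with block hj r = R, {t | 𝒜.Computes r t}.ncard :=
    (Set.ncard_le_ncard subset (Set.toFinite _)).trans (set_ncard_biUnion_le _ _)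
  refine Nat.le_of_mul_le_mul_left ?_ (show 0 < 2 ^ (k - j) by positivity)
  calc 2 ^ (k - j) * ({t | (𝒜.fold hj).Computes R t}.ncard * 2 ^ j)
      = {t | (𝒜.fold hj).Computes R t}.ncard * 2 ^ k := by
        rw [mul_left_comm, ← pow_add, Nat.sub_add_cancel hj]
    _ ≤ (∑ r : Fin (2 ^ k) with block hj r = R, {t | 𝒜.Computes r t}.ncard) * 2 ^ k :=
        Nat.mul_le_mul_right _ ncard_le
    _ ≤ #{r : Fin (2 ^ k) | block hj r = R} * N ^ 3 := by
        rw [sum_mul]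
        exact sum_le_card_nsmul _ _ _ fun r _ => h r
    _ ≤ 2 ^ (k - j) * N ^ 3 := Nat.mul_le_mul_right _ (card_block_eq_le hj R)

theorem EvenTerms.balancedTerms {𝒜 : Algorithm k N} (h : 𝒜.EvenTerms) : 𝒜.BalancedTerms := by
  intro r
  rw [le_div_iff₀ (lt_min (by positivity) (by norm_num))]
  calc ({t | 𝒜.Computes r t}.ncard : ℝ) * min ((2 : ℝ) ^ k) (11 ^ 3)
      ≤ {t | 𝒜.Computes r t}.ncard * 2 ^ k := by gcongr; exact min_le_left _ _
    _ ≤ (N : ℝ) ^ 3 := by exact_mod_cast h r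

theorem inClass_of_evenTerms {𝒜 : Algorithm k N} (solves : 𝒜.Solves)
    (noReplication : 𝒜.NoReplication) (evenTerms : 𝒜.EvenTerms) : 𝒜.InClass :=
  ⟨⟨solves, noReplication, evenTerms.balancedTerms⟩, fun _ _ hj =>
    ⟨solves.fold hj.le, noReplication.fold hj.le, (evenTerms.fold hj.le).balancedTerms⟩⟩

end Folding

end Algorithm

/-! ### The free semiring -/

section FreeSemiring

variable {X : Type*}

/-- The coefficient of a word in an element of the free semiring, which is represented as a linear
combination of words with coefficients in `ℕ`. -/
noncomputable def wordCoeff (x : FreeAlgebra ℕ X) (w : FreeMonoid X) : ℕ :=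
  (FreeAlgebra.equivMonoidAlgebraFreeMonoid x).coeff w

theorem wordCoeff_ext {x y : FreeAlgebra ℕ X} (h : ∀ w, wordCoeff x w = wordCoeff y w) : x = y :=
  FreeAlgebra.equivMonoidAlgebraFreeMonoid.injective (MonoidAlgebra.ext (Finsupp.ext h))

@[simp] theorem wordCoeff_add (x y : FreeAlgebra ℕ X) (w : FreeMonoid X) :
    wordCoeff (x + y) w = wordCoeff x w + wordCoeff y w := by
  simp [wordCoeff]

@[simp] theorem wordCoeff_zero (w : FreeMonoid X) : wordCoeff (0 : FreeAlgebra ℕ X) w = 0 := by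
  simp [wordCoeff]

theorem wordCoeff_sum {ι : Type*} (s : Finset ι) (f : ι → FreeAlgebra ℕ X) (w : FreeMonoid X) :
    wordCoeff (∑ i ∈ s, f i) w = ∑ i ∈ s, wordCoeff (f i) w :=
  map_sum (⟨⟨(wordCoeff · w), wordCoeff_zero w⟩, fun x y => wordCoeff_add x y w⟩ :
    FreeAlgebra ℕ X →+ ℕ) f s

open Classical in
theorem wordCoeff_one (w : FreeMonoid X) :
    wordCoeff (1 : FreeAlgebra ℕ X) w = if w = 1 then 1 else 0 := by
  simp [wordCoeff, MonoidAlgebra.one_def, Finsupp.single_apply, eq_comm]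

theorem equivMonoidAlgebraFreeMonoid_ι (x : X) :
    FreeAlgebra.equivMonoidAlgebraFreeMonoid (FreeAlgebra.ι ℕ x) =
      MonoidAlgebra.single (FreeMonoid.of x) 1 := by
  simp [FreeAlgebra.equivMonoidAlgebraFreeMonoid]

open Classical in
theorem wordCoeff_ι (x : X) (w : FreeMonoid X) :
    wordCoeff (FreeAlgebra.ι ℕ x) w = if w = FreeMonoid.of x then 1 else 0 := by
  simp [wordCoeff, equivMonoidAlgebraFreeMonoid_ι, Finsupp.single_apply, eq_comm]

open Classical in
theorem wordCoeff_ι_mul_ι (x y : X) (w : FreeMonoid X) :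
    wordCoeff (FreeAlgebra.ι ℕ x * FreeAlgebra.ι ℕ y) w =
      if w = FreeMonoid.of x * FreeMonoid.of y then 1 else 0 := by
  simp [wordCoeff, equivMonoidAlgebraFreeMonoid_ι, Finsupp.single_apply, eq_comm]

theorem wordCoeff_mul_wordCoeff_le (x y : FreeAlgebra ℕ X) (u v : FreeMonoid X) :
    wordCoeff x u * wordCoeff y v ≤ wordCoeff (x * y) (u * v) := by
  classical
  by_cases hu : wordCoeff x u = 0
  · simp [hu]
  by_cases hv : wordCoeff y v = 0
  · simp [hv]
  simp only [wordCoeff, map_mul] at *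
  rw [MonoidAlgebra.coeff_mul, Finsupp.sum]
  refine le_trans ?_ (Finset.single_le_sum (f := fun a => _) (fun _ _ => Nat.zero_le _)
    (Finsupp.mem_support_iff.2 hu))
  rw [Finsupp.sum]
  refine le_trans ?_ (Finset.single_le_sum (f := fun a => _) (fun _ _ => Nat.zero_le _)
    (Finsupp.mem_support_iff.2 hv))
  simp

theorem exists_of_wordCoeff_mul_ne_zero {x y : FreeAlgebra ℕ X} {w : FreeMonoid X}
    (h : wordCoeff (x * y) w ≠ 0) : ∃ u v, u * v = w ∧ wordCoeff x u ≠ 0 ∧ wordCoeff y v ≠ 0 := by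
  classical
  simp only [wordCoeff, map_mul] at *
  rw [MonoidAlgebra.coeff_mul, Finsupp.sum] at h
  obtain ⟨u, hu, h⟩ := Finset.exists_ne_zero_of_sum_ne_zero h
  rw [Finsupp.sum] at h
  obtain ⟨v, hv, h⟩ := Finset.exists_ne_zero_of_sum_ne_zero h
  exact ⟨u, v, by_contra fun e => h (if_neg e), Finsupp.mem_support_iff.1 hu,
    Finsupp.mem_support_iff.1 hv⟩

theorem eq_ι_of_wordCoeff {x : FreeAlgebra ℕ X} {e : X} (of : wordCoeff x (FreeMonoid.of e) = 1)
    (ne_of : ∀ w, w ≠ FreeMonoid.of e → wordCoeff x w = 0) : x = FreeAlgebra.ι ℕ e := by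
  refine wordCoeff_ext fun w => ?_
  rw [wordCoeff_ι]
  split_ifs with hw
  · rw [hw, of]
  · exact ne_of w hw

theorem eq_one_or_eq_one_of_mul_eq_of {u v : FreeMonoid X} {x : X}
    (h : u * v = FreeMonoid.of x) : u = 1 ∨ v = 1 := by
  have h' : u.toList ++ v.toList = [x] := h
  rcases List.append_eq_cons_iff.1 h' with ⟨hu, -⟩ | ⟨l, -, hl⟩
  · exact .inl hu
  · exact .inr (List.append_eq_nil_iff.1 hl.symm).2

theorem eq_of_of_mul_eq_of_mul_of {u v : FreeMonoid X} {x y : X} (hu : u ≠ 1) (hv : v ≠ 1)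
    (h : u * v = FreeMonoid.of x * FreeMonoid.of y) :
    u = FreeMonoid.of x ∧ v = FreeMonoid.of y := by
  have h' : u.toList ++ v.toList = [x, y] := h
  rcases List.append_eq_cons_iff.1 h' with ⟨hu', -⟩ | ⟨l, hul, hl⟩
  · exact absurd hu' hu
  rcases List.append_eq_cons_iff.1 hl.symm with ⟨rfl, hv'⟩ | ⟨l', -, hl'⟩
  · exact ⟨hul, hv'⟩
  · exact absurd (List.append_eq_nil_iff.1 hl'.symm).2 hv

/-- `x` is a partial sum of `T`, written as a sum of words with repetition, and the word `w` occurs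
in it.  As no semiring operation removes words, a computation of `T` can be traced backwards along
such values to the place where `w` came into being. -/
def IsPartialSum (T : FreeAlgebra ℕ X) (w : FreeMonoid X) (x : FreeAlgebra ℕ X) : Prop :=
  (∀ u, wordCoeff x u ≤ wordCoeff T u) ∧ wordCoeff x w ≠ 0

namespace IsPartialSum

variable {T x y : FreeAlgebra ℕ X} {w : FreeMonoid X}

theorem ne_zero (h : IsPartialSum T w x) : x ≠ 0 := by
  rintro rfl
  exact h.2 (wordCoeff_zero w)

theorem ne_one (h : IsPartialSum T w x) (hw : w ≠ 1) : x ≠ 1 := by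
  rintro rfl
  exact h.2 (by rw [wordCoeff_one, if_neg hw])

theorem of_add (h : IsPartialSum T w (x + y)) : IsPartialSum T w x ∨ IsPartialSum T w y := by
  obtain ⟨hle, hw⟩ := h
  simp only [wordCoeff_add] at hle hw
  by_cases hx : wordCoeff x w = 0
  · exact .inr ⟨fun u => (Nat.le_add_left _ _).trans (hle u), fun hy => hw (by omega)⟩
  · exact .inl ⟨fun u => (Nat.le_add_right _ _).trans (hle u), hx⟩

theorem of_mul (h : IsPartialSum T w (x * y)) :
    IsPartialSum T w x ∨ IsPartialSum T w y ∨
      ∃ u v, u * v = w ∧ u ≠ 1 ∧ v ≠ 1 ∧ wordCoeff x u ≠ 0 ∧ wordCoeff y v ≠ 0 := by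
  obtain ⟨u, v, rfl, hu, hv⟩ := exists_of_wordCoeff_mul_ne_zero h.2
  have hle (u v) : wordCoeff x u * wordCoeff y v ≤ wordCoeff T (u * v) :=
    (wordCoeff_mul_wordCoeff_le x y u v).trans (h.1 _)
  rcases eq_or_ne u 1 with rfl | hu1
  · refine .inr (.inl ⟨fun w => ?_, by rwa [one_mul]⟩)
    have hw := hle 1 w
    rw [one_mul] at hw
    exact (Nat.le_mul_of_pos_left _ (Nat.pos_of_ne_zero hu)).trans hw
  rcases eq_or_ne v 1 with rfl | hv1
  · refine .inl ⟨fun w => ?_, by rwa [mul_one]⟩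
    have hw := hle w 1
    rw [mul_one] at hw
    exact (Nat.le_mul_of_pos_right _ (Nat.pos_of_ne_zero hv)).trans hw
  exact .inr (.inr ⟨u, v, rfl, hu1, hv1, hu, hv⟩)

theorem of_mul_letter {e : X} (h : IsPartialSum T (FreeMonoid.of e) (x * y)) :
    IsPartialSum T (FreeMonoid.of e) x ∨ IsPartialSum T (FreeMonoid.of e) y := by
  rcases h.of_mul with hx | hy | ⟨u, v, huv, hu, hv, -⟩
  · exact .inl hx
  · exact .inr hy
  · exact ((eq_one_or_eq_one_of_mul_eq_of huv).elim hu hv).elim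

end IsPartialSum

theorem isPartialSum_ι_iff {e : X} {x : FreeAlgebra ℕ X} :
    IsPartialSum (FreeAlgebra.ι ℕ e) (FreeMonoid.of e) x ↔ x = FreeAlgebra.ι ℕ e := by
  classical
  constructor
  · rintro ⟨hle, he⟩
    simp only [wordCoeff_ι] at hle
    refine eq_ι_of_wordCoeff ?_ fun w hw => Nat.le_zero.1 ((hle w).trans_eq (if_neg hw))
    exact ((hle _).trans_eq (if_pos rfl)).antisymm (Nat.pos_of_ne_zero he)
  · rintro rfl
    exact ⟨fun _ => le_rfl, by simp [wordCoeff_ι]⟩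


end FreeSemiring

section GenericProduct

variable {N : ℕ} {i l j i' l' j' : Fin N}

/-- The `(i, j)` entry of the product of the generic matrices, whose entries are the generators of
the free semiring. -/
noncomputable def genericProduct (i j : Fin N) : FreeAlgebra ℕ (Entry N) :=
  ∑ l, FreeAlgebra.ι ℕ (Entry.A i l) * FreeAlgebra.ι ℕ (Entry.B l j)

/-- The multiplicative term `A[i,l] B[l,j]` as a word in the input entries. -/
def termWord (i l j : Fin N) : FreeMonoid (Entry N) :=
  FreeMonoid.of (Entry.A i l) * FreeMonoid.of (Entry.B l j)

theorem toList_termWord (i l j : Fin N) :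
    (termWord i l j).toList = [Entry.A i l, Entry.B l j] := rfl

theorem termWord_inj : termWord i l j = termWord i' l' j' ↔ i = i' ∧ l = l' ∧ j = j' := by
  rw [← FreeMonoid.toList.injective.eq_iff, toList_termWord, toList_termWord]
  simp only [List.cons.injEq, Entry.A.injEq, Entry.B.injEq]
  tauto

theorem termWord_ne_one (i l j : Fin N) : termWord i l j ≠ 1 := fun h =>
  List.cons_ne_nil _ _ ((toList_termWord i l j).symm.trans (congrArg FreeMonoid.toList h))

theorem of_ne_termWord (e : Entry N) (i l j : Fin N) : FreeMonoid.of e ≠ termWord i l j :=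
  fun h => by simpa [toList_termWord] using congrArg FreeMonoid.toList h

theorem eq_of_A_of_mul_of_B_eq_termWord {w : FreeMonoid (Entry N)}
    (h : w * FreeMonoid.of (Entry.B l j) = termWord i l' j) : w = FreeMonoid.of (Entry.A i l) := by
  have h' : w.toList ++ [Entry.B l j] = [Entry.A i l'] ++ [Entry.B l' j] := h
  obtain ⟨hw, hB⟩ := List.append_inj' h' rfl
  obtain ⟨rfl, -⟩ := Entry.B.inj (List.cons.inj hB).1
  exact hw

theorem eq_of_B_of_of_A_mul_eq_termWord {w : FreeMonoid (Entry N)}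
    (h : FreeMonoid.of (Entry.A i l) * w = termWord i l' j) : w = FreeMonoid.of (Entry.B l j) := by
  have h' : [Entry.A i l] ++ w.toList = [Entry.A i l'] ++ [Entry.B l' j] := h
  obtain ⟨hA, hw⟩ := List.append_inj h' rfl
  obtain ⟨-, rfl⟩ := Entry.A.inj (List.cons.inj hA).1
  exact hw

open Classical in
theorem wordCoeff_genericProduct (i j : Fin N) (w : FreeMonoid (Entry N)) :
    wordCoeff (genericProduct i j) w = if ∃ l, w = termWord i l j then 1 else 0 := by
  simp only [genericProduct, wordCoeff_sum, wordCoeff_ι_mul_ι]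
  change ∑ l, (if w = termWord i l j then 1 else 0) = _
  split_ifs with h
  · obtain ⟨l, rfl⟩ := h
    simp [termWord_inj]
  · exact Finset.sum_eq_zero fun l _ => if_neg fun hw => h ⟨l, hw⟩

namespace IsPartialSum

theorem genericProduct_self (i l j : Fin N) :
    IsPartialSum (genericProduct i j) (termWord i l j) (genericProduct i j) := by
  classical
  refine ⟨fun _ => le_rfl, ?_⟩
  rw [wordCoeff_genericProduct, if_pos ⟨l, rfl⟩]
  exact one_ne_zero

theorem eq_of_genericProduct {x : FreeAlgebra ℕ (Entry N)}
    (h : IsPartialSum (genericProduct i j) (termWord i l j) x)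
    (h' : IsPartialSum (genericProduct i' j') (termWord i' l' j') x) : i = i' ∧ j = j' := by
  classical
  have hpos := (Nat.pos_of_ne_zero h.2).trans_le (h'.1 _)
  rw [wordCoeff_genericProduct] at hpos
  split_ifs at hpos with hw
  · obtain ⟨l', hw⟩ := hw
    exact ⟨(termWord_inj.1 hw).1, (termWord_inj.1 hw).2.2⟩
  · exact absurd hpos (lt_irrefl 0)

theorem of_mul_term {x y : FreeAlgebra ℕ (Entry N)}
    (h : IsPartialSum (genericProduct i j) (termWord i l j) (x * y)) :
    IsPartialSum (genericProduct i j) (termWord i l j) x ∨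
      IsPartialSum (genericProduct i j) (termWord i l j) y ∨
        x = FreeAlgebra.ι ℕ (Entry.A i l) ∧ y = FreeAlgebra.ι ℕ (Entry.B l j) := by
  classical
  rcases h.of_mul with hx | hy | ⟨u, v, huv, hu1, hv1, hu, hv⟩
  · exact .inl hx
  · exact .inr (.inl hy)
  obtain ⟨rfl, rfl⟩ := eq_of_of_mul_eq_of_mul_of hu1 hv1 huv
  have hle (a b) : wordCoeff x a * wordCoeff y b ≤ if ∃ l, a * b = termWord i l j then 1 else 0 :=
    wordCoeff_genericProduct i j (a * b) ▸ (wordCoeff_mul_wordCoeff_le x y a b).trans (h.1 _)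
  -- The coefficients of `A[i,l]` in `x` and of `B[l,j]` in `y` have product `1`; hence any further
  -- word of `x` or `y` would yield a word of `x * y` that is no term of the entry `(i, j)`.
  obtain ⟨hx1, hy1⟩ : wordCoeff x (.of (.A i l)) = 1 ∧ wordCoeff y (.of (.B l j)) = 1 := by
    have hone := hle (.of (.A i l)) (.of (.B l j))
    rw [if_pos ⟨l, rfl⟩] at hone
    exact mul_eq_one.1 (hone.antisymm (Nat.mul_pos (Nat.pos_of_ne_zero hu)
      (Nat.pos_of_ne_zero hv)))
  refine .inr (.inr ⟨eq_ι_of_wordCoeff hx1 fun w hw => ?_, eq_ι_of_wordCoeff hy1 fun w hw => ?_⟩)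
  · have hzero := hle w (.of (.B l j))
    rw [hy1, mul_one, if_neg] at hzero
    · exact Nat.le_zero.1 hzero
    · exact fun ⟨_, hw'⟩ => hw (eq_of_A_of_mul_of_B_eq_termWord hw')
  · have hzero := hle (.of (.A i l)) w
    rw [hx1, one_mul, if_neg] at hzero
    · exact Nat.le_zero.1 hzero
    · exact fun ⟨_, hw'⟩ => hw (eq_of_B_of_of_A_mul_eq_termWord hw')

end IsPartialSum

end GenericProduct

/-! ### Tracing values -/

/-- A property of semiring elements that survives backwards through semiring operations: a result
with the property `P` has an operand with this property, unless it is the product of two elements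
related by `E`. -/
structure Traceable {S : Type*} [Semiring S] (P : S → Prop) (E : S → S → Prop) : Prop where
  not_zero : ¬ P 0
  not_one : ¬ P 1
  of_add : ∀ {x y}, P (x + y) → P x ∨ P y
  of_mul : ∀ {x y}, P (x * y) → P x ∨ P y ∨ E x y

theorem traceable_eq_ι {X : Type*} (e : X) :
    Traceable (· = FreeAlgebra.ι ℕ e) fun _ _ => False where
  not_zero h := (isPartialSum_ι_iff.2 h).ne_zero rfl
  not_one h := (isPartialSum_ι_iff.2 h).ne_one (FreeMonoid.of_ne_one e) rfl
  of_add h := by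
    simp only [← isPartialSum_ι_iff] at h ⊢
    exact h.of_add
  of_mul h := by
    simp only [← isPartialSum_ι_iff, or_false] at h ⊢
    exact h.of_mul_letter

theorem traceable_isPartialSum_termWord {N : ℕ} (i l j : Fin N) :
    Traceable (IsPartialSum (genericProduct i j) (termWord i l j))
      fun x y => x = FreeAlgebra.ι ℕ (Entry.A i l) ∧ y = FreeAlgebra.ι ℕ (Entry.B l j) where
  not_zero h := h.ne_zero rfl
  not_one h := h.ne_one (termWord_ne_one i l j) rfl
  of_add h := h.of_add
  of_mul h := h.of_mul_term

section Tracing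

variable {Reg S : Type} [Semiring S] {P : S → Prop} {E : S → S → Prop}

/-- Some multiplication in `code`, run on the memory `mem`, has operands related by `E`. -/
def Multiplies (E : S → S → Prop) (code : List (Instr Reg)) (mem : Reg → S) : Prop :=
  ∃ (c₁ c₂ : List (Instr Reg)) (d x y : Reg),
    code = c₁ ++ Instr.mul d x y :: c₂ ∧ E (runCode c₁ mem x) (runCode c₁ mem y)

theorem Multiplies.append {code : List (Instr Reg)} {mem : Reg → S} (h : Multiplies E code mem)
    (c : List (Instr Reg)) : Multiplies E (code ++ c) mem := by
  obtain ⟨c₁, c₂, d, x, y, rfl, hE⟩ := h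
  exact ⟨c₁, c₂ ++ c, d, x, y, by rw [List.append_assoc, List.cons_append], hE⟩

theorem not_multiplies_false (code : List (Instr Reg)) (mem : Reg → S) :
    ¬ Multiplies (fun _ _ => False) code mem :=
  fun ⟨_, _, _, _, _, _, h⟩ => h

namespace Traceable

theorem of_exec (h : Traceable P E) {I : Instr Reg} {mem : Reg → S} {d : Reg}
    (hd : P (I.exec mem d)) :
    (∃ x, P (mem x)) ∨ ∃ d x y, I = Instr.mul d x y ∧ E (mem x) (mem y) := by
  classical
  cases I with
  | zero e =>
    rw [Instr.exec, Function.update_apply] at hd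
    split_ifs at hd
    exacts [(h.not_zero hd).elim, .inl ⟨d, hd⟩]
  | one e =>
    rw [Instr.exec, Function.update_apply] at hd
    split_ifs at hd
    exacts [(h.not_one hd).elim, .inl ⟨d, hd⟩]
  | add e x y =>
    rw [Instr.exec, Function.update_apply] at hd
    split_ifs at hd
    exacts [.inl ((h.of_add hd).elim (⟨x, ·⟩) (⟨y, ·⟩)), .inl ⟨d, hd⟩]
  | mul e x y =>
    rw [Instr.exec, Function.update_apply] at hd
    split_ifs at hd
    · rcases h.of_mul hd with hx | hy | hxy
      exacts [.inl ⟨x, hx⟩, .inl ⟨y, hy⟩, .inr ⟨e, x, y, rfl, hxy⟩]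
    · exact .inl ⟨d, hd⟩

theorem of_runCode (h : Traceable P E) {code : List (Instr Reg)} {mem : Reg → S} {d : Reg}
    (hd : P (runCode code mem d)) : (∃ x, P (mem x)) ∨ Multiplies E code mem := by
  induction code using List.reverseRecOn generalizing d with
  | nil => exact .inl ⟨d, hd⟩
  | append_singleton c I ih =>
    rw [runCode_append, runCode_cons, runCode_nil] at hd
    rcases h.of_exec hd with ⟨x, hx⟩ | ⟨e, x, y, rfl, hE⟩
    · exact (ih hx).imp_right (Multiplies.append · _)
    · exact .inr ⟨c, [], e, x, y, rfl, hE⟩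

end Traceable

end Tracing

namespace Step

variable {k : ℕ} {Reg : Type} (st : Step k Reg) (r : Fin (2 ^ k))

theorem card_src_le_degree : (st.msgs.filter fun μ => μ.src = r ∧ μ.dst ≠ r).card ≤ st.degree :=
  (le_max_left _ _).trans (Finset.le_sup (f := fun r => max
    (st.msgs.filter fun μ => μ.src = r ∧ μ.dst ≠ r).card
    (st.msgs.filter fun μ => μ.dst = r ∧ μ.src ≠ r).card) (Finset.mem_univ r))

theorem card_dst_le_degree : (st.msgs.filter fun μ => μ.dst = r ∧ μ.src ≠ r).card ≤ st.degree :=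
  (le_max_right _ _).trans (Finset.le_sup (f := fun r => max
    (st.msgs.filter fun μ => μ.src = r ∧ μ.dst ≠ r).card
    (st.msgs.filter fun μ => μ.dst = r ∧ μ.src ≠ r).card) (Finset.mem_univ r))

theorem degree_eq_zero {st : Step k Reg} (h : k ≤ st.label) : st.degree = 0 := by
  have local_msgs : ∀ μ ∈ st.msgs, μ.src = μ.dst := by
    intro μ hμ
    have hcluster := st.cluster μ hμ
    rw [Nat.sub_eq_zero_of_le h, pow_zero, Nat.div_one, Nat.div_one] at hcluster
    exact Fin.ext hcluster
  rw [degree, ← Nat.le_zero]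
  refine Finset.sup_le fun r _ => ?_
  rw [max_le_iff, Nat.le_zero, Nat.le_zero, Finset.card_eq_zero, Finset.card_eq_zero,
    Finset.filter_eq_empty_iff, Finset.filter_eq_empty_iff]
  exact ⟨fun μ hμ hr => hr.2 ((local_msgs μ hμ).symm.trans hr.1),
    fun μ hμ hr => hr.2 ((local_msgs μ hμ).trans hr.1)⟩

end Step

namespace Algorithm

variable {k N : ℕ} {S : Type} [Semiring S]

section Messages

variable (𝒜 : Algorithm k N)

/-- The memory before step `t`. -/
noncomputable def memAt (inst : Entry N → S) (t : ℕ) : Fin (2 ^ k) → 𝒜.Reg → S :=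
  (𝒜.steps.take t).foldl Step.exec (𝒜.start inst)

theorem memAt_length (inst : Entry N → S) :
    𝒜.memAt inst 𝒜.steps.length = 𝒜.final inst := by
  rw [memAt, List.take_length, final]

theorem memAt_succ (inst : Entry N → S) (t : Fin 𝒜.steps.length) :
    𝒜.memAt inst (t + 1) = Step.exec (𝒜.memAt inst t) (𝒜.steps.get t) := by
  rw [memAt, List.take_succ_eq_append_getElem t.isLt, List.foldl_append]
  rfl

/-- The value transported by the message `m.2` of step `m.1`. -/
noncomputable def msgValue (inst : Entry N → S)
    (m : (_ : Fin 𝒜.steps.length) × Message k 𝒜.Reg) : S :=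
  runCode ((𝒜.steps.get m.1).code m.2.src) (𝒜.memAt inst m.1 m.2.src) m.2.srcReg

/-- The messages that PE `r` sends to other PEs, each with the index of its step. -/
def sent (r : Fin (2 ^ k)) : Finset ((_ : Fin 𝒜.steps.length) × Message k 𝒜.Reg) :=
  Finset.univ.sigma fun t => (𝒜.steps.get t).msgs.filter fun μ => μ.src = r ∧ μ.dst ≠ r

/-- The messages that PE `r` receives from other PEs, each with the index of its step. -/
def received (r : Fin (2 ^ k)) : Finset ((_ : Fin 𝒜.steps.length) × Message k 𝒜.Reg) :=
  Finset.univ.sigma fun t => (𝒜.steps.get t).msgs.filter fun μ => μ.dst = r ∧ μ.src ≠ r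

/-- The sum of the degrees of all steps. -/
def totalDegree : ℕ := (𝒜.steps.map Step.degree).sum

theorem totalDegree_eq_sum : 𝒜.totalDegree = ∑ t, (𝒜.steps.get t).degree := by
  rw [totalDegree, ← List.sum_ofFn]
  congr 1
  conv_lhs => rw [← List.ofFn_get 𝒜.steps, List.map_ofFn]
  rfl

theorem card_sent_le_totalDegree (r : Fin (2 ^ k)) : (𝒜.sent r).card ≤ 𝒜.totalDegree := by
  rw [sent, Finset.card_sigma, totalDegree_eq_sum]
  exact Finset.sum_le_sum fun t _ => (𝒜.steps.get t).card_src_le_degree r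

theorem card_received_le_totalDegree (r : Fin (2 ^ k)) :
    (𝒜.received r).card ≤ 𝒜.totalDegree := by
  rw [received, Finset.card_sigma, totalDegree_eq_sum]
  exact Finset.sum_le_sum fun t _ => (𝒜.steps.get t).card_dst_le_degree r

end Messages

variable {𝒜 : Algorithm k N} {P : S → Prop} {E : S → S → Prop} {inst : Entry N → S}

/-- PE `r` is a place of origin of the values with the property `P`: such a value is initially
there, or PE `r` multiplies two values related by `E`. -/
def Origin (𝒜 : Algorithm k N) (inst : Entry N → S) (P : S → Prop) (E : S → S → Prop)
    (r : Fin (2 ^ k)) : Prop :=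
  (∃ d, P (𝒜.start inst r d)) ∨
    ∃ t : Fin 𝒜.steps.length, Multiplies E ((𝒜.steps.get t).code r) (𝒜.memAt inst t r)

/-- Values with the property `P` get from PE `r` to PE `r'`: either the two PEs are the same, or
`r` sends such a value and `r'` receives one, possibly with other PEs in between. -/
def Travels (𝒜 : Algorithm k N) (inst : Entry N → S) (P : S → Prop) (r r' : Fin (2 ^ k)) : Prop :=
  r = r' ∨ (∃ m ∈ 𝒜.sent r, P (𝒜.msgValue inst m)) ∧ ∃ m ∈ 𝒜.received r', P (𝒜.msgValue inst m)

theorem Travels.send {t : Fin 𝒜.steps.length} {μ : Message k 𝒜.Reg} {r : Fin (2 ^ k)}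
    (h : 𝒜.Travels inst P r μ.src) (hμ : μ ∈ (𝒜.steps.get t).msgs)
    (hP : P (𝒜.msgValue inst ⟨t, μ⟩)) : 𝒜.Travels inst P r μ.dst := by
  by_cases hne : μ.src = μ.dst
  · exact hne ▸ h
  have hreceived : ⟨t, μ⟩ ∈ 𝒜.received μ.dst := by simpa [received, hne] using hμ
  rcases h with rfl | ⟨hsent, -⟩
  · have hsent : ⟨t, μ⟩ ∈ 𝒜.sent μ.src := by simpa [sent, Ne.symm hne] using hμ
    exact .inr ⟨⟨_, hsent, hP⟩, _, hreceived, hP⟩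
  · exact .inr ⟨hsent, _, hreceived, hP⟩

theorem exists_origin (h : Traceable P E) {t : ℕ} (ht : t ≤ 𝒜.steps.length) {r : Fin (2 ^ k)}
    {d : 𝒜.Reg} (hd : P (𝒜.memAt inst t r d)) :
    ∃ r₀, 𝒜.Origin inst P E r₀ ∧ 𝒜.Travels inst P r₀ r := by
  induction t generalizing r d with
  | zero => exact ⟨r, .inl ⟨d, hd⟩, .inl rfl⟩
  | succ t ih =>
    have after_code : ∀ r d,
        P (runCode ((𝒜.steps.get ⟨t, ht⟩).code r) (𝒜.memAt inst t r) d) →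
          ∃ r₀, 𝒜.Origin inst P E r₀ ∧ 𝒜.Travels inst P r₀ r := by
      intro r d hd
      rcases h.of_runCode hd with ⟨x, hx⟩ | hmul
      · exact ih (Nat.le_of_succ_le ht) hx
      · exact ⟨r, .inr ⟨⟨t, ht⟩, hmul⟩, .inl rfl⟩
    rw [𝒜.memAt_succ inst ⟨t, ht⟩] at hd
    rcases Step.exec_cases (𝒜.memAt inst t) (𝒜.steps.get ⟨t, ht⟩) r d with
      ⟨μ, hμ, rfl, rfl, hexec⟩ | ⟨-, hexec⟩
    · rw [hexec] at hd
      obtain ⟨r₀, horigin, htravels⟩ := after_code _ _ hd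
      exact ⟨r₀, horigin, htravels.send hμ hd⟩
    · rw [hexec] at hd
      exact after_code _ _ hd

theorem exists_input_of_start (hP : ¬ P 0) {r : Fin (2 ^ k)} {d : 𝒜.Reg}
    (hd : P (𝒜.start inst r d)) : ∃ e, 𝒜.input r d = some e ∧ P (inst e) := by
  rw [start] at hd
  cases hin : 𝒜.input r d with
  | none =>
    rw [hin] at hd
    exact (hP hd).elim
  | some e =>
    rw [hin] at hd
    exact ⟨e, rfl, hd⟩

theorem computes_of_multiplies {t : Fin 𝒜.steps.length} {r : Fin (2 ^ k)} {i l j : Fin N}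
    (h : Multiplies (fun x y => x = FreeAlgebra.ι ℕ (Entry.A i l) ∧
      y = FreeAlgebra.ι ℕ (Entry.B l j)) ((𝒜.steps.get t).code r)
      (𝒜.memAt (FreeAlgebra.ι ℕ) t r)) : 𝒜.Computes r (i, l, j) := by
  obtain ⟨c₁, c₂, d, x, y, hcode, hx, hy⟩ := h
  refine ⟨𝒜.steps.take t, 𝒜.steps.drop (t + 1), 𝒜.steps.get t, c₁, c₂, d, x, y, ?_, hcode, hx, hy⟩
  rw [List.get_eq_getElem, ← List.drop_eq_getElem_cons, List.take_append_drop]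

theorem Solves.final_ι_output (h : 𝒜.Solves) (i j : Fin N) :
    𝒜.final (FreeAlgebra.ι ℕ) (𝒜.output i j).1 (𝒜.output i j).2 = genericProduct i j := by
  have hval : Entry.val (fun i j => FreeAlgebra.ι ℕ (Entry.A i j))
      (fun i j => FreeAlgebra.ι ℕ (Entry.B i j)) = FreeAlgebra.ι ℕ (X := Entry N) :=
    funext fun e => by cases e <;> rfl
  rw [← hval]
  exact h _ _ _ i j

theorem Solves.exists_computes (h : 𝒜.Solves) (i l j : Fin N) :
    ∃ r, 𝒜.Computes r (i, l, j) ∧ 𝒜.Travels (FreeAlgebra.ι ℕ)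
      (IsPartialSum (genericProduct i j) (termWord i l j)) r (𝒜.output i j).1 := by
  have htrace := traceable_isPartialSum_termWord i l j
  obtain ⟨r, ⟨d, hd⟩ | ⟨t, hmul⟩, htravels⟩ := exists_origin (𝒜 := 𝒜) (inst := FreeAlgebra.ι ℕ)
    (r := (𝒜.output i j).1) (d := (𝒜.output i j).2) htrace le_rfl (by
      rw [memAt_length, h.final_ι_output]
      exact IsPartialSum.genericProduct_self i l j)
  · obtain ⟨e, -, he⟩ := exists_input_of_start htrace.not_zero hd
    refine absurd (he.1 (FreeMonoid.of e)) ?_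
    classical
    rw [wordCoeff_ι, if_pos rfl, wordCoeff_genericProduct,
      if_neg fun ⟨l', hl'⟩ => of_ne_termWord e i l' j hl']
    norm_num
  · exact ⟨r, computes_of_multiplies hmul, htravels⟩

/-- PE `r` holds the input entry `e` initially or receives its value in some step. -/
def Obtains (𝒜 : Algorithm k N) (r : Fin (2 ^ k)) (e : Entry N) : Prop :=
  (∃ d, 𝒜.input r d = some e) ∨
    ∃ m ∈ 𝒜.received r, 𝒜.msgValue (FreeAlgebra.ι ℕ) m = FreeAlgebra.ι ℕ e

theorem obtains_of_runCode_eq {e : Entry N} {before after : List (Step k 𝒜.Reg)}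
    {st : Step k 𝒜.Reg} (hsteps : 𝒜.steps = before ++ st :: after) {r : Fin (2 ^ k)}
    {c : List (Instr 𝒜.Reg)} {x : 𝒜.Reg}
    (hx : runCode c (before.foldl Step.exec (𝒜.start (FreeAlgebra.ι ℕ)) r) x =
      FreeAlgebra.ι ℕ e) : 𝒜.Obtains r e := by
  have htrace := traceable_eq_ι e
  obtain ⟨d, hd⟩ := (htrace.of_runCode hx).resolve_right (not_multiplies_false _ _)
  have hbefore : before.foldl Step.exec (𝒜.start (FreeAlgebra.ι ℕ)) =
      𝒜.memAt (FreeAlgebra.ι ℕ) before.length := by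
    rw [memAt, hsteps, List.take_left]
  rw [hbefore] at hd
  obtain ⟨r₀, ⟨d', hd'⟩ | ⟨t, hmul⟩, htravels⟩ := exists_origin htrace (by simp [hsteps]) hd
  · rcases htravels with rfl | ⟨-, hreceived⟩
    · obtain ⟨e', he', hι⟩ := exists_input_of_start (P := (· = _)) htrace.not_zero hd'
      exact .inl ⟨d', FreeAlgebra.ι_injective hι ▸ he'⟩
    · exact .inr hreceived
  · exact (not_multiplies_false _ _ hmul).elim

theorem Computes.obtains {r : Fin (2 ^ k)} {t : Fin N × Fin N × Fin N} (h : 𝒜.Computes r t) :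
    𝒜.Obtains r (.A t.1 t.2.1) ∧ 𝒜.Obtains r (.B t.2.1 t.2.2) := by
  obtain ⟨before, after, st, c₁, c₂, d, x, y, hsteps, -, hx, hy⟩ := h
  exact ⟨obtains_of_runCode_eq hsteps hx, obtains_of_runCode_eq hsteps hy⟩

end Algorithm

/-! ### The lower bound -/

namespace Algorithm

open Finset

variable {k N : ℕ} {𝒜 : Algorithm k N}

open Classical in
theorem card_le_card_input_add_totalDegree {α : Type*} [Fintype α] {g : α → Entry N}
    (hg : Function.Injective g) {r : Fin (2 ^ k)} {s : Finset α}
    (hs : ∀ a ∈ s, 𝒜.Obtains r (g a)) :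
    #s ≤ #{a | ∃ d, 𝒜.input r d = some (g a)} + 𝒜.totalDegree := by
  refine (card_le_card_add_card_of_forall_mem_or (t := 𝒜.received r)
    (fun a m => 𝒜.msgValue (FreeAlgebra.ι ℕ) m = FreeAlgebra.ι ℕ (g a)) (fun a ha => ?_) ?_).trans
    (Nat.add_le_add_left (𝒜.card_received_le_totalDegree r) _)
  · rw [mem_filter_univ]
    exact hs a ha
  · exact fun a a' m h h' => hg (FreeAlgebra.ι_injective (h.symm.trans h'))

open Classical in
theorem card_le_card_output_add_totalDegree {r : Fin (2 ^ k)} {s : Finset (Fin N × Fin N)}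
    (hs : ∀ w ∈ s, ∃ l, 𝒜.Travels (FreeAlgebra.ι ℕ)
      (IsPartialSum (genericProduct w.1 w.2) (termWord w.1 l w.2)) r (𝒜.output w.1 w.2).1) :
    #s ≤ #{w : Fin N × Fin N | r = (𝒜.output w.1 w.2).1} + 𝒜.totalDegree := by
  refine (card_le_card_add_card_of_forall_mem_or (t := 𝒜.sent r)
    (fun w m => ∃ l, IsPartialSum (genericProduct w.1 w.2) (termWord w.1 l w.2)
      (𝒜.msgValue (FreeAlgebra.ι ℕ) m)) (fun w hw => ?_) ?_).trans
    (Nat.add_le_add_left (𝒜.card_sent_le_totalDegree r) _)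
  · rw [mem_filter_univ]
    obtain ⟨l, hr | ⟨⟨m, hm, hP⟩, -⟩⟩ := hs w hw
    exacts [.inl hr, .inr ⟨m, hm, l, hP⟩]
  · rintro w w' m ⟨l, h⟩ ⟨l', h'⟩
    exact Prod.ext_iff.2 (h.eq_of_genericProduct h')

open Classical in
theorem NoReplication.sum_card_input_le (h : 𝒜.NoReplication) {α : Type*} [Fintype α]
    (g : α → Entry N) :
    ∑ r, #{a | ∃ d, 𝒜.input r d = some (g a)} ≤ Fintype.card α :=
  sum_card_filter_le _ fun _ _ _ ⟨_, hd⟩ ⟨_, hd'⟩ => (h _ _ _ _ _ hd hd').1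

open Classical in
theorem sq_div_pow_three_le_totalDegree (solves : 𝒜.Solves) (noReplication : 𝒜.NoReplication)
    (half : ∀ r, ({t | 𝒜.Computes r t}.ncard : ℝ) ≤ (N : ℝ) ^ 3 / 2) :
    ((N : ℝ) ^ 2 / 50) ^ 3 ≤ (𝒜.totalDegree : ℝ) ^ 3 * ((2 : ℝ) ^ k) ^ 2 := by
  choose f computes travels using fun t : Fin N × Fin N × Fin N =>
    solves.exists_computes t.1 t.2.1 t.2.2
  have card_pairs : Fintype.card (Fin N × Fin N) = Fintype.card (Fin N) ^ 2 := by
    rw [Fintype.card_prod, sq]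
  have bound := le_surplus_of_card_image_le f (d := 𝒜.totalDegree)
    (a := fun r => #{w : Fin N × Fin N | ∃ d, 𝒜.input r d = some (.A w.1 w.2)})
    (b := fun r => #{w : Fin N × Fin N | ∃ d, 𝒜.input r d = some (.B w.1 w.2)})
    (c := fun r => #{w : Fin N × Fin N | r = (𝒜.output w.1 w.2).1})
    (fun r => card_le_card_input_add_totalDegree
      (fun w w' h => Prod.ext_iff.2 (Entry.A.inj h)) (forall_mem_image.2 fun t ht =>
        (mem_filter_univ t).1 ht ▸ (computes t).obtains.1))
    (fun r => card_le_card_input_add_totalDegree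
      (fun w w' h => Prod.ext_iff.2 (Entry.B.inj h)) (forall_mem_image.2 fun t ht =>
        (mem_filter_univ t).1 ht ▸ (computes t).obtains.2))
    (fun r => card_le_card_output_add_totalDegree (forall_mem_image.2 fun t ht =>
      ⟨t.2.1, (mem_filter_univ t).1 ht ▸ travels t⟩))
    ((noReplication.sum_card_input_le _).trans_eq card_pairs)
    ((noReplication.sum_card_input_le _).trans_eq card_pairs)
    ((sum_card_filter_le _ fun _ _ _ h h' => h.trans h'.symm).trans_eq card_pairs)
    (fun r => ?_)
  · simpa only [Fintype.card_fin, Nat.cast_pow, Nat.cast_ofNat] using bound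
  · rw [Fintype.card_fin]
    refine le_trans (Nat.cast_le.2 ?_) (half r)
    rw [← Set.ncard_coe_finset]
    refine Set.ncard_le_ncard (fun t ht => ?_) (Set.toFinite _)
    exact (mem_filter_univ t).1 (mem_coe.1 ht) ▸ computes t

theorem commComplexity_eq_sum (𝒜 : Algorithm k N) (σ : ℝ) :
    𝒜.commComplexity σ =
      ((𝒜.steps.filter fun st => st.label < k).map fun st => (st.degree : ℝ) + σ).sum := by
  rw [← sum_range_sum_map_filter_eq, commComplexity]
  refine sum_congr rfl fun i _ => ?_
  rw [cumDegree, numSupersteps, List.sum_map_add, List.map_const', List.sum_replicate,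
    nsmul_eq_mul, Nat.cast_list_sum, List.map_map]
  rfl

theorem totalDegree_le_commComplexity (𝒜 : Algorithm k N) {σ : ℝ} (hσ : 0 ≤ σ) :
    (𝒜.totalDegree : ℝ) ≤ 𝒜.commComplexity σ := by
  rw [commComplexity_eq_sum, totalDegree]
  induction 𝒜.steps with
  | nil => simp
  | cons st l ih =>
    rw [List.filter_cons, List.map_cons, List.sum_cons]
    split_ifs with h
    · rw [List.map_cons, List.sum_cons, Nat.cast_add]
      linarith
    · rw [Step.degree_eq_zero (by simpa using h), zero_add]
      exact ih

theorem InClass.commComplexity_ge (h : 𝒜.InClass) (hk : 1 ≤ k) {σ : ℝ} (hσ : 0 ≤ σ) :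
    (N : ℝ) ^ 2 / ((2 : ℝ) ^ k) ^ (2 / 3 : ℝ) / 50 ≤ 𝒜.commComplexity σ := by
  obtain ⟨⟨solves, noReplication, balancedTerms⟩, -⟩ := h
  refine le_trans ?_ (𝒜.totalDegree_le_commComplexity hσ)
  rw [div_right_comm]
  refine div_rpow_two_thirds_le (Nat.cast_nonneg _) (by positivity)
    (sq_div_pow_three_le_totalDegree solves noReplication fun r => (balancedTerms r).trans ?_)
  gcongr
  exact le_min (le_self_pow₀ one_le_two (Nat.one_le_iff_ne_zero.1 hk)) (by norm_num)

theorem InClass.isOptimal_of_commComplexity_le (h : 𝒜.InClass) (hk : 1 ≤ k) {σ c : ℝ}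
    (hσ : 0 ≤ σ) (hc : 0 ≤ c)
    (hle : 𝒜.commComplexity σ ≤ c * ((N : ℝ) ^ 2 / ((2 : ℝ) ^ k) ^ (2 / 3 : ℝ))) :
    𝒜.IsOptimal (1 / (50 * c)) σ := by
  refine ⟨h, fun ℬ hℬ => hle.trans ?_⟩
  rw [one_div_one_div]
  linarith [mul_le_mul_of_nonneg_left (hℬ.commComplexity_ge hk hσ) hc]

end Algorithm

/-! ### Correctness of the recursive algorithm -/

/-- The register that receives the result of an operation. -/
def Instr.target {Reg : Type} : Instr Reg → Reg
  | .zero d => d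
  | .one d => d
  | .add d _ _ => d
  | .mul d _ _ => d

theorem runCode_of_forall_target_ne {Reg S : Type} [Semiring S] {code : List (Instr Reg)} {d : Reg}
    (h : ∀ op ∈ code, op.target ≠ d) (mem : Reg → S) : runCode code mem d = mem d := by
  classical
  induction code generalizing mem with
  | nil => rfl
  | cons op code ih =>
    rw [runCode_cons, ih fun op' hop' => h op' (List.mem_cons_of_mem _ hop')]
    have hop := h op List.mem_cons_self
    cases op <;> exact Function.update_of_ne hop.symm _ _

namespace MM

variable {m : ℕ} {S : Type} [Semiring S]

theorem levels_le (m : ℕ) : levels m ≤ m := by unfold levels; omega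

theorem levels_pos (hm : 1 ≤ m) : 0 < levels m := by unfold levels; omega

theorem blk_lt {i : ℕ} (hi : i ≤ m) (a : Fin (2 ^ m)) : blk i a < 2 ^ i := by
  rw [blk, Nat.div_lt_iff_lt_mul (by positivity), ← pow_add, Nat.add_sub_cancel' hi]
  exact a.isLt

/-- The value that `entryCode` computes from the contents of the memory. -/
def entryVal (i z : ℕ) (a b : Fin (2 ^ m)) (mem : Reg m → S) : S :=
  if i = levels m then
    ∑ c : Fin (2 ^ m) with blk i c = z, mem (.A i (blk i b) a c) * mem (.B i (blk i a) c b)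
  else mem (.C (i + 1) (2 * z) a b) + mem (.C (i + 1) (2 * z + 1) a b)

theorem entryVal_congr {i z : ℕ} {a b : Fin (2 ^ m)} {mem mem' : Reg m → S}
    (h : ∀ d, (∀ z a b, d ≠ .C i z a b) → d ≠ .tmp → mem d = mem' d) :
    entryVal i z a b mem = entryVal i z a b mem' := by
  unfold entryVal
  split_ifs
  · refine Finset.sum_congr rfl fun c _ => ?_
    rw [h _ (by simp) (by simp), h _ (by simp) (by simp)]
  · rw [h _ (by simp) (by simp), h _ (by simp) (by simp)]

theorem target_of_mem_entryCode {i z : ℕ} {a b : Fin (2 ^ m)} {op : Instr (Reg m)}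
    (h : op ∈ entryCode i z a b) : op.target = .C i z a b ∨ op.target = .tmp := by
  unfold entryCode at h
  split_ifs at h
  · simp only [List.mem_cons, List.mem_flatMap, List.not_mem_nil, or_false] at h
    rcases h with rfl | ⟨c, -, rfl | rfl⟩ <;> simp [Instr.target]
  · simp only [List.mem_cons, List.not_mem_nil, or_false] at h
    simp [h, Instr.target]

theorem runCode_accumulate {i z : ℕ} {a b : Fin (2 ^ m)} (l : List (Fin (2 ^ m)))
    (mem : Reg m → S) :
    runCode (l.flatMap fun c => [.mul .tmp (.A i (blk i b) a c) (.B i (blk i a) c b),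
        .add (.C i z a b) (.C i z a b) .tmp]) mem (.C i z a b) =
      mem (.C i z a b) +
        (l.map fun c => mem (.A i (blk i b) a c) * mem (.B i (blk i a) c b)).sum := by
  induction l generalizing mem with
  | nil => simp
  | cons c l ih =>
    rw [List.flatMap_cons, runCode_append, ih]
    simp [runCode_cons, Instr.exec, add_assoc]

theorem runCode_entryCode (i z : ℕ) (a b : Fin (2 ^ m)) (mem : Reg m → S) :
    runCode (entryCode i z a b) mem (.C i z a b) = entryVal i z a b mem := by
  classical
  unfold entryCode entryVal
  split_ifs
  · rw [runCode_cons, runCode_accumulate]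
    simp only [Instr.exec, Function.update_self, zero_add]
    rw [← List.sum_toFinset _ ((List.nodup_finRange _).filter _)]
    refine Finset.sum_congr (by ext c; simp) fun c _ => ?_
    rw [Function.update_of_ne (by simp), Function.update_of_ne (by simp)]
  · simp [runCode_cons, Instr.exec]

/-- The entries of the products of level `i` for which PE `r` is responsible, each given by the
third coordinate of its subproblem and its row and column. -/
def jobs (πC : Layout m) (i : ℕ) (r : Fin (2 ^ (2 * m))) :
    List (ℕ × Fin (2 ^ m) × Fin (2 ^ m)) :=
  (List.range (2 ^ i)).flatMap fun z =>
    (List.finRange (2 ^ m)).flatMap fun a =>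
      (List.finRange (2 ^ m)).flatMap fun b =>
        if homeC πC i z a b = r then [(z, a, b)] else []

theorem mem_jobs {πC : Layout m} {i : ℕ} {r : Fin (2 ^ (2 * m))} {z : ℕ} {a b : Fin (2 ^ m)} :
    (z, a, b) ∈ jobs πC i r ↔ z < 2 ^ i ∧ homeC πC i z a b = r := by
  simp only [jobs, List.mem_flatMap, List.mem_range, List.mem_finRange, true_and]
  constructor
  · rintro ⟨z', hz, a', b', h⟩
    split_ifs at h with hr
    · simp only [List.mem_singleton, Prod.mk.injEq] at h
      obtain ⟨rfl, rfl, rfl⟩ := h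
      exact ⟨hz, hr⟩
    · simp at h
  · rintro ⟨hz, hr⟩
    exact ⟨z, hz, a, b, by simp [hr]⟩

theorem prodCode_eq_flatMap_jobs (πC : Layout m) (i : ℕ) (r : Fin (2 ^ (2 * m))) :
    prodCode πC i r = (jobs πC i r).flatMap fun w => entryCode i w.1 w.2.1 w.2.2 := by
  simp only [prodCode, jobs, List.flatMap_assoc]
  congr 1; ext1 z; congr 1; ext1 a; congr 1; ext1 b
  split_ifs <;> simp

-- `entryCode` writes only to `tmp` and to the register of its own entry, so the last job with
-- target `C i z a b` finds its operands unchanged, and later jobs do not overwrite its result.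
theorem runCode_flatMap_entryCode (i : ℕ) (l : List (ℕ × Fin (2 ^ m) × Fin (2 ^ m)))
    (mem : Reg m → S) {w : ℕ × Fin (2 ^ m) × Fin (2 ^ m)} (hw : w ∈ l) :
    runCode (l.flatMap fun w => entryCode i w.1 w.2.1 w.2.2) mem (.C i w.1 w.2.1 w.2.2) =
      entryVal i w.1 w.2.1 w.2.2 mem := by
  induction l using List.reverseRecOn with
  | nil => simp at hw
  | append_singleton l v ih =>
    rw [List.flatMap_append, runCode_append, List.flatMap_cons, List.flatMap_nil, List.append_nil]
    by_cases hv : v = w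
    · subst hv
      rw [runCode_entryCode]
      refine entryVal_congr fun d hC htmp => runCode_of_forall_target_ne (fun op hop => ?_) mem
      obtain ⟨u, -, hu⟩ := List.mem_flatMap.1 hop
      rcases target_of_mem_entryCode hu with h | h <;> rintro rfl
      exacts [hC _ _ _ h, htmp h]
    · have hw' : w ∈ l := (List.mem_append.1 hw).resolve_right fun h =>
        hv (List.mem_singleton.1 h).symm
      rw [runCode_of_forall_target_ne, ih hw']
      intro op hop
      rcases target_of_mem_entryCode hop with h | h <;> rw [h]
      · intro hC
        simp only [Reg.C.injEq, true_and] at hC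
        exact hv (Prod.ext hC.1 (Prod.ext hC.2.1 hC.2.2))
      · simp

theorem runCode_prodCode {πC : Layout m} {i z : ℕ} {a b : Fin (2 ^ m)} (hz : z < 2 ^ i)
    (mem : Reg m → S) :
    runCode (prodCode πC i (homeC πC i z a b)) mem (.C i z a b) = entryVal i z a b mem := by
  rw [prodCode_eq_flatMap_jobs]
  exact runCode_flatMap_entryCode i _ mem (w := (z, a, b)) (mem_jobs.2 ⟨hz, rfl⟩)

theorem target_of_mem_prodCode {πC : Layout m} {i : ℕ} {r : Fin (2 ^ (2 * m))} {op : Instr (Reg m)}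
    (h : op ∈ prodCode πC i r) : (∃ z a b, op.target = .C i z a b) ∨ op.target = .tmp := by
  rw [prodCode_eq_flatMap_jobs] at h
  obtain ⟨u, -, hu⟩ := List.mem_flatMap.1 h
  exact (target_of_mem_entryCode hu).imp_left fun h => ⟨_, _, _, h⟩

theorem mem_triples {i y : ℕ} (hy : y < 2 ^ i) (a c : Fin (2 ^ m)) : (a, c, y) ∈ triples m i := by
  simp [triples, hy]

/-- The invariant of the distribution phase: the inputs of all subproblems of level `i` are where
the algorithm expects them. -/
def HasInputs (πA πB : Layout m) (inst : Entry (2 ^ m) → S) (i : ℕ)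
    (mem : Fin (2 ^ (2 * m)) → Reg m → S) : Prop :=
  (∀ y < 2 ^ i, ∀ a c, mem (homeA πA i y a c) (.A i y a c) = inst (.A a c)) ∧
    ∀ x < 2 ^ i, ∀ c b, mem (homeB πB i x c b) (.B i x c b) = inst (.B c b)

theorem HasInputs.exec_distStep {πA πB : Layout m} {inst : Entry (2 ^ m) → S} {i : ℕ}
    {mem : Fin (2 ^ (2 * m)) → Reg m → S} (h : HasInputs πA πB inst i mem) (hi : i < levels m) :
    HasInputs πA πB inst (i + 1) (Step.exec mem (distStep πA πB i hi)) := by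
  classical
  have half_lt {y : ℕ} (hy : y < 2 ^ (i + 1)) : y / 2 < 2 ^ i := by
    rw [pow_succ] at hy
    omega
  constructor
  · intro y hy a c
    refine (Step.exec_of_mem mem (distStep πA πB i hi) (μ := ⟨homeA πA i (y / 2) a c,
      homeA πA (i + 1) y a c, .A i (y / 2) a c, .A (i + 1) y a c⟩) ?_).trans
        (h.1 _ (half_lt hy) a c)
    exact Finset.mem_union_left _ (Finset.mem_union_left _
      (Finset.mem_image.2 ⟨(a, c, y), mem_triples hy a c, rfl⟩))
  · intro x hx c b
    refine (Step.exec_of_mem mem (distStep πA πB i hi) (μ := ⟨homeB πB i (x / 2) c b,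
      homeB πB (i + 1) x c b, .B i (x / 2) c b, .B (i + 1) x c b⟩) ?_).trans
        (h.2 _ (half_lt hx) c b)
    exact Finset.mem_union_left _ (Finset.mem_union_right _
      (Finset.mem_image.2 ⟨(c, b, x), mem_triples hx c b, rfl⟩))

/-- The entry `(a, b)` of the product of the subproblem of level `i` with third coordinate `z`. -/
def partialProduct (inst : Entry (2 ^ m) → S) (i z : ℕ) (a b : Fin (2 ^ m)) : S :=
  ∑ c : Fin (2 ^ m) with blk i c = z, inst (.A a c) * inst (.B c b)

theorem partialProduct_zero (inst : Entry (2 ^ m) → S) (a b : Fin (2 ^ m)) :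
    partialProduct inst 0 0 a b = ∑ c, inst (.A a c) * inst (.B c b) := by
  rw [partialProduct, Finset.filter_true_of_mem fun c _ => by simp [blk]]

theorem partialProduct_succ (inst : Entry (2 ^ m) → S) {i : ℕ} (hi : i + 1 ≤ m) (z : ℕ)
    (a b : Fin (2 ^ m)) :
    partialProduct inst (i + 1) (2 * z) a b + partialProduct inst (i + 1) (2 * z + 1) a b =
      partialProduct inst i z a b := by
  rw [partialProduct, partialProduct, partialProduct, ← Finset.sum_union]
  · refine Finset.sum_congr ?_ fun _ _ => rfl
    ext c
    have := blk_succ hi c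
    simp only [Finset.mem_union, Finset.mem_filter, Finset.mem_univ, true_and]
    omega
  · rw [Finset.disjoint_filter]
    omega

/-- The invariant of the collection phase: the values from which the products of level `i` are
computed are available. -/
def Ready (πC : Layout m) (inst : Entry (2 ^ m) → S) (i : ℕ)
    (mem : Fin (2 ^ (2 * m)) → Reg m → S) : Prop :=
  ∀ z < 2 ^ i, ∀ a b, entryVal i z a b (mem (homeC πC i z a b)) = partialProduct inst i z a b

theorem spread_levels_val {g : ℕ} (hg : g < 8 ^ levels m) (a b : Fin (2 ^ m)) :
    (spread m (levels m) g a b).val = g / 2 ^ (levels m - 2 * (m - levels m)) := by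
  have hpow : 2 ^ levels m = 4 ^ (m - levels m) * 2 ^ (levels m - 2 * (m - levels m)) := by
    rw [show (4 : ℕ) = 2 ^ 2 by norm_num, ← pow_mul, ← pow_add]
    congr 1
    unfold levels
    omega
  rw [spread_val (levels_le m) hg]
  conv_lhs => rw [hpow]
  rw [← Nat.div_div_eq_div_mul, add_comm, Nat.add_mul_div_right _ _ (by positivity),
    Nat.div_eq_of_lt (offset_lt _ a b), zero_add]

theorem spread_levels_eq {g : ℕ} (hg : g < 8 ^ levels m) (a b a' b' : Fin (2 ^ m)) :
    spread m (levels m) g a b = spread m (levels m) g a' b' :=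
  Fin.ext ((spread_levels_val hg a b).trans (spread_levels_val hg a' b').symm)

-- A subproblem of the last level is solved by a single PE, which holds both operands.
theorem HasInputs.ready {πA πB : Layout m} {inst : Entry (2 ^ m) → S} (hm : 1 ≤ m)
    {mem : Fin (2 ^ (2 * m)) → Reg m → S} (h : HasInputs πA πB inst (levels m) mem)
    (πC : Layout m) : Ready πC inst (levels m) mem := by
  intro z _ a b
  rw [entryVal, if_pos rfl]
  refine Finset.sum_congr rfl fun c hc => ?_
  obtain rfl : blk (levels m) c = z := (Finset.mem_filter.1 hc).2
  have hne := (levels_pos hm).ne'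
  have home_eq_A : homeC πC (levels m) (blk (levels m) c) a b =
      homeA πA (levels m) (blk (levels m) b) a c := by
    rw [homeC, homeA, if_neg hne, if_neg hne]
    exact spread_levels_eq (seg_lt ..) ..
  have home_eq_B : homeC πC (levels m) (blk (levels m) c) a b =
      homeB πB (levels m) (blk (levels m) a) c b := by
    rw [homeC, homeB, if_neg hne, if_neg hne]
    exact spread_levels_eq (seg_lt ..) ..
  congr 1
  · rw [home_eq_A, h.1 _ (blk_lt (levels_le m) b) a c]
  · rw [home_eq_B, h.2 _ (blk_lt (levels_le m) a) c b]

theorem Ready.exec_collStep {πC : Layout m} {inst : Entry (2 ^ m) → S} {i : ℕ}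
    {mem : Fin (2 ^ (2 * m)) → Reg m → S} (h : Ready πC inst (i + 1) mem) (hi : i < levels m) :
    Ready πC inst i (Step.exec mem (collStep πC i hi)) := by
  classical
  intro z hz a b
  have collected : ∀ z' < 2 ^ (i + 1), z' / 2 = z →
      Step.exec mem (collStep πC i hi) (homeC πC i z a b) (.C (i + 1) z' a b) =
        partialProduct inst (i + 1) z' a b := by
    rintro z' hz' rfl
    refine (Step.exec_of_mem mem (collStep πC i hi) (μ := ⟨homeC πC (i + 1) z' a b,
      homeC πC i (z' / 2) a b, .C (i + 1) z' a b, .C (i + 1) z' a b⟩) ?_).trans ?_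
    · exact Finset.mem_union_left _ (Finset.mem_image.2 ⟨(a, b, z'), mem_triples hz' a b, rfl⟩)
    · exact (runCode_prodCode hz' _).trans (h z' hz' a b)
  rw [pow_succ] at collected
  rw [entryVal, if_neg hi.ne, collected _ (by omega) (by omega), collected _ (by omega) (by omega),
    partialProduct_succ inst (level_le hi).1]

theorem Ready.exec_lastStep {πC : Layout m} {inst : Entry (2 ^ m) → S}
    {mem : Fin (2 ^ (2 * m)) → Reg m → S} (h : Ready πC inst 0 mem) (hL : 0 < levels m)
    (a b : Fin (2 ^ m)) :
    Step.exec mem (lastStep πC hL) (πC (a, b)) (.C 0 0 a b) =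
      ∑ c, inst (.A a c) * inst (.B c b) := by
  rw [Step.exec_of_forall_ne, ← partialProduct_zero]
  · exact (runCode_prodCode (πC := πC) (i := 0) (by simp) _).trans (h 0 (by simp) a b)
  · intro μ hμ _ hdst
    obtain ⟨t, ht⟩ := dummies_reg μ hμ
    simp [ht] at hdst

theorem hasInputs_start (hm : 1 ≤ m) (πA πB πC : Layout m) (inst : Entry (2 ^ m) → S) :
    HasInputs πA πB inst 0 ((algorithm hm πA πB πC).start inst) := by
  constructor
  · intro y hy a c
    obtain rfl : y = 0 := by simpa using hy
    simp [Algorithm.start, algorithm, homeA]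
  · intro x hx c b
    obtain rfl : x = 0 := by simpa using hx
    simp [Algorithm.start, algorithm, homeB]

theorem algorithm_solves (hm : 1 ≤ m) (πA πB πC : Layout m) :
    (algorithm hm πA πB πC).Solves := by
  intro S _ A B a b
  have distributed := foldl_finRange_induction (HasInputs πA πB (Entry.val A B))
    (fun mem (i : Fin (levels m)) => Step.exec mem (distStep πA πB i i.isLt))
    (hasInputs_start hm πA πB πC (Entry.val A B)) fun i _ h => h.exec_distStep i.isLt
  have collected := foldl_finRange_reverse_induction (Ready πC (Entry.val A B))
    (fun mem (i : Fin (levels m)) => Step.exec mem (collStep πC i i.isLt))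
    (distributed.ready hm πC) fun i _ h => h.exec_collStep i.isLt
  refine Eq.trans ?_ (collected.exec_lastStep (levels_pos hm) a b)
  simp only [Algorithm.final, algorithm, List.foldl_append, List.foldl_map, List.foldl_cons,
    List.foldl_nil]

end MM

/-! ### Membership in the class -/

namespace MM

open Finset

variable {m : ℕ}

theorem seg_inj {i x y z x' y' z' : ℕ} (hx : x < 2 ^ i) (hy : y < 2 ^ i) (hz : z < 2 ^ i)
    (hx' : x' < 2 ^ i) (hy' : y' < 2 ^ i) (hz' : z' < 2 ^ i)
    (h : seg i x y z = seg i x' y' z') : x = x' ∧ y = y' ∧ z = z' := by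
  induction i generalizing x y z x' y' z' with
  | zero => simp_all
  | succ i ih =>
    simp only [pow_succ, seg] at *
    have halves := ih (x := x / 2) (y := y / 2) (z := z / 2) (x' := x' / 2) (y' := y' / 2)
      (z' := z' / 2) (by omega) (by omega) (by omega) (by omega) (by omega) (by omega) (by omega)
    omega

theorem eq_of_blk_eq_of_mod_eq {i : ℕ} {a a' : Fin (2 ^ m)} (hblk : blk i a = blk i a')
    (hmod : a.val % 2 ^ (m - i) = a'.val % 2 ^ (m - i)) : a = a' := by
  unfold blk at hblk
  rw [Fin.ext_iff, ← Nat.div_add_mod a.val (2 ^ (m - i)), hblk, hmod, Nat.div_add_mod]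

/-- The position of the entry `(a, b)` of the subproblem number `g` in the concatenation of the
lists of the entries of all subproblems of level `i`, which `spread` cuts into pieces of length
`2 ^ i`. -/
def position (i g : ℕ) (a b : Fin (2 ^ m)) : ℕ :=
  g * 4 ^ (m - i) + (a.val % 2 ^ (m - i) * 2 ^ (m - i) + b.val % 2 ^ (m - i))

/-- A numbering `f` of the subproblems of level `i`, where `f a b y` is the number of the
subproblem that has the entry `(a, b)` of one of the three matrices and the value `y` of the
coordinate that is not determined by this entry. -/
structure IsNumbering (i : ℕ) (f : Fin (2 ^ m) → Fin (2 ^ m) → ℕ → ℕ) : Prop where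
  lt : ∀ a b y, f a b y < 8 ^ i
  inj : ∀ {a b y a' b' y'}, y < 2 ^ i → y' < 2 ^ i → f a b y = f a' b' y' →
    blk i a = blk i a' ∧ blk i b = blk i b' ∧ y = y'

theorem isNumbering_A {i : ℕ} (hi : i ≤ m) :
    IsNumbering (m := m) i fun a c y => seg i (blk i a) y (blk i c) where
  lt _ _ _ := seg_lt ..
  inj hy hy' h := by
    obtain ⟨ha, hy, hc⟩ := seg_inj (blk_lt hi _) hy (blk_lt hi _) (blk_lt hi _) hy' (blk_lt hi _) h
    exact ⟨ha, hc, hy⟩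

theorem isNumbering_B {i : ℕ} (hi : i ≤ m) :
    IsNumbering (m := m) i fun c b x => seg i x (blk i b) (blk i c) where
  lt _ _ _ := seg_lt ..
  inj hx hx' h := by
    obtain ⟨hx, hb, hc⟩ := seg_inj hx (blk_lt hi _) (blk_lt hi _) hx' (blk_lt hi _) (blk_lt hi _) h
    exact ⟨hc, hb, hx⟩

theorem isNumbering_C {i : ℕ} (hi : i ≤ m) :
    IsNumbering (m := m) i fun a b z => seg i (blk i a) (blk i b) z where
  lt _ _ _ := seg_lt ..
  inj hz hz' h := seg_inj (blk_lt hi _) (blk_lt hi _) hz (blk_lt hi _) (blk_lt hi _) hz' h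

theorem IsNumbering.position_inj {i : ℕ} {f : Fin (2 ^ m) → Fin (2 ^ m) → ℕ → ℕ}
    (hf : IsNumbering i f) {a b a' b' : Fin (2 ^ m)} {y y' : ℕ} (hy : y < 2 ^ i) (hy' : y' < 2 ^ i)
    (h : position i (f a b y) a b = position i (f a' b' y') a' b') :
    a = a' ∧ b = b' ∧ y = y' := by
  obtain ⟨number_eq, offset_eq⟩ := add_mul_inj_of_lt (offset_lt i a b) (offset_lt i a' b') h
  obtain ⟨blk_a, blk_b, rfl⟩ := hf.inj hy hy' number_eq
  obtain ⟨mod_a, mod_b⟩ := add_mul_inj_of_lt (Nat.mod_lt _ (by positivity))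
    (Nat.mod_lt _ (by positivity)) offset_eq
  exact ⟨eq_of_blk_eq_of_mod_eq blk_a mod_a, eq_of_blk_eq_of_mod_eq blk_b mod_b, rfl⟩

theorem IsNumbering.card_home_eq_le {i : ℕ} (hi : i ≤ m) (π : Layout m)
    {f : Fin (2 ^ m) → Fin (2 ^ m) → ℕ → ℕ} (hf : IsNumbering i f) (r : Fin (2 ^ (2 * m))) :
    #{w ∈ triples m i | (if i = 0 then π (w.1, w.2.1)
      else spread m i (f w.1 w.2.1 w.2.2) w.1 w.2.1) = r} ≤ 2 ^ i := by
  rw [← card_range (2 ^ i)]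
  refine card_le_card_of_injOn (fun w => position i (f w.1 w.2.1 w.2.2) w.1 w.2.1 % 2 ^ i)
    (fun w _ => mem_coe.2 (mem_range.2 (Nat.mod_lt _ (by positivity)))) ?_
  rintro ⟨a, b, y⟩ hw ⟨a', b', y'⟩ hw'
    (hmod : position i (f a b y) a b % 2 ^ i = position i (f a' b' y') a' b' % 2 ^ i)
  simp only [triples, coe_filter, mem_product, mem_univ, true_and, mem_range,
    Set.mem_ofPred_eq] at hw hw'
  rcases Nat.eq_zero_or_pos i with rfl | hi0
  · simp only [if_true, pow_zero, Nat.lt_one_iff] at hw hw'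
    obtain ⟨rfl, rfl⟩ := Prod.mk.inj (π.injective (hw.2.trans hw'.2.symm))
    rw [hw.1, hw'.1]
  · rw [if_neg hi0.ne'] at hw hw'
    have hdiv := congrArg Fin.val (hw.2.trans hw'.2.symm)
    rw [spread_val hi (hf.lt ..), spread_val hi (hf.lt ..)] at hdiv
    have position_eq : position i (f a b y) a b = position i (f a' b' y') a' b' := by
      rw [← Nat.div_add_mod (position i (f a b y) a b) (2 ^ i), hmod, position, hdiv]
      exact Nat.div_add_mod _ _
    obtain ⟨rfl, rfl, rfl⟩ := hf.position_inj hw.1 hw'.1 position_eq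
    rfl

theorem card_homeA_eq_le {i : ℕ} (hi : i ≤ m) (π : Layout m) (r : Fin (2 ^ (2 * m))) :
    #{w ∈ triples m i | homeA π i w.2.2 w.1 w.2.1 = r} ≤ 2 ^ i :=
  (isNumbering_A hi).card_home_eq_le hi π r

theorem card_homeB_eq_le {i : ℕ} (hi : i ≤ m) (π : Layout m) (r : Fin (2 ^ (2 * m))) :
    #{w ∈ triples m i | homeB π i w.2.2 w.1 w.2.1 = r} ≤ 2 ^ i :=
  (isNumbering_B hi).card_home_eq_le hi π r

theorem card_homeC_eq_le {i : ℕ} (hi : i ≤ m) (π : Layout m) (r : Fin (2 ^ (2 * m))) :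
    #{w ∈ triples m i | homeC π i w.2.2 w.1 w.2.1 = r} ≤ 2 ^ i :=
  (isNumbering_C hi).card_home_eq_le hi π r

theorem card_homeC_levels_eq_le (π : Layout m) (r : Fin (2 ^ (2 * m))) :
    #{t : Fin (2 ^ m) × Fin (2 ^ m) × Fin (2 ^ m) |
      homeC π (levels m) (blk (levels m) t.2.1) t.1 t.2.2 = r} ≤ 2 ^ m := by
  have hL := levels_le m
  calc _ ≤ #({w ∈ triples m (levels m) | homeC π (levels m) w.2.2 w.1 w.2.1 = r} ×ˢ
        range (2 ^ (m - levels m))) := by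
        refine card_le_card_of_injOn
          (fun t => ((t.1, t.2.2, blk (levels m) t.2.1), t.2.1.val % 2 ^ (m - levels m))) ?_ ?_
        · intro t ht
          refine mem_coe.2 (mem_product.2 ⟨mem_filter.2 ⟨mem_triples (blk_lt hL _) _ _, ?_⟩,
            mem_range.2 (Nat.mod_lt _ (by positivity))⟩)
          exact (mem_filter.1 ht).2
        · rintro ⟨a, c, b⟩ _ ⟨a', c', b'⟩ _ h
          simp only [Prod.mk.injEq] at h ⊢
          exact ⟨h.1.1, eq_of_blk_eq_of_mod_eq h.1.2.2 h.2, h.1.2.1⟩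
    _ ≤ 2 ^ levels m * 2 ^ (m - levels m) := by
        rw [card_product, card_range]
        exact Nat.mul_le_mul_right _ (card_homeC_eq_le hL π r)
    _ = 2 ^ m := by rw [← pow_add, Nat.add_sub_cancel' hL]

/-- The PE and the register in which an input entry is initially stored. -/
def inputPlace (πA πB : Layout m) : Entry (2 ^ m) → Fin (2 ^ (2 * m)) × Reg m
  | .A a c => (πA (a, c), .A 0 0 a c)
  | .B c b => (πB (c, b), .B 0 0 c b)

/-- The input entry, if any, that a register is reserved for copies of. -/
def Reg.entry : Reg m → Option (Entry (2 ^ m))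
  | .A _ _ a c => some (.A a c)
  | .B _ _ c b => some (.B c b)
  | _ => none

/-- The registers that are reserved for copies of an input entry hold this entry or `0`. -/
def OnlyCopies {S : Type} [Semiring S] (inst : Entry (2 ^ m) → S)
    (mem : Fin (2 ^ (2 * m)) → Reg m → S) : Prop :=
  ∀ r d e, d.entry = some e → mem r d = 0 ∨ mem r d = inst e

theorem entry_target_eq_none_of_mem_prodCode {πC : Layout m} {i : ℕ} {r : Fin (2 ^ (2 * m))}
    {op : Instr (Reg m)} (h : op ∈ prodCode πC i r) : op.target.entry = none := by
  rcases target_of_mem_prodCode h with ⟨z, a, b, h⟩ | h <;> rw [h, Reg.entry] <;> simp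

theorem runCode_eq_of_entry_eq_some {S : Type} [Semiring S] {code : List (Instr (Reg m))}
    (hcode : ∀ op ∈ code, op.target.entry = none) {d : Reg m} {e : Entry (2 ^ m)}
    (hd : d.entry = some e) (mem : Reg m → S) : runCode code mem d = mem d := by
  refine runCode_of_forall_target_ne (fun op hop hop_eq => ?_) mem
  have := hcode op hop
  simp [hop_eq, hd] at this

theorem OnlyCopies.exec {S : Type} [Semiring S] {inst : Entry (2 ^ m) → S}
    {mem : Fin (2 ^ (2 * m)) → Reg m → S} (h : OnlyCopies inst mem) {st : Step (2 * m) (Reg m)}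
    (hcode : ∀ r, ∀ op ∈ st.code r, op.target.entry = none)
    (hmsgs : ∀ μ ∈ st.msgs, ∀ e, μ.dstReg.entry = some e → μ.srcReg.entry = some e) :
    OnlyCopies inst (Step.exec mem st) := by
  intro r d e hd
  rcases Step.exec_cases mem st r d with ⟨μ, hμ, -, rfl, hexec⟩ | ⟨-, hexec⟩
  · have hsrc := hmsgs μ hμ e hd
    rw [hexec, runCode_eq_of_entry_eq_some (hcode _) hsrc]
    exact h _ _ _ hsrc
  · rw [hexec, runCode_eq_of_entry_eq_some (hcode _) hd]
    exact h _ _ _ hd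

theorem mul_mem_prodCode {πC : Layout m} {i : ℕ} {r : Fin (2 ^ (2 * m))} {d x y : Reg m}
    (h : Instr.mul d x y ∈ prodCode πC i r) :
    ∃ a c b, homeC πC (levels m) (blk (levels m) c) a b = r ∧ x.entry = some (.A a c) ∧
      y.entry = some (.B c b) := by
  rw [prodCode_eq_flatMap_jobs] at h
  obtain ⟨⟨z, a, b⟩, hw, h⟩ := List.mem_flatMap.1 h
  unfold entryCode at h
  split_ifs at h with hi
  · simp only [List.mem_cons, List.mem_flatMap, List.not_mem_nil, or_false, reduceCtorEq, false_or,
      Instr.mul.injEq, List.mem_filter, decide_eq_true_eq] at h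
    obtain ⟨c, ⟨-, rfl⟩, -, rfl, rfl⟩ := h
    exact ⟨a, c, b, hi ▸ (mem_jobs.1 hw).2, rfl, rfl⟩
  · simp at h

section Algorithm

variable {hm : 1 ≤ m} {πA πB πC : Layout m}

theorem eq_inputPlace_of_input_eq_some {r : Fin (2 ^ (2 * m))} {d : Reg m} {e : Entry (2 ^ m)}
    (h : (algorithm hm πA πB πC).input r d = some e) : (r, d) = inputPlace πA πB e := by
  simp only [algorithm] at h
  split at h
  · split_ifs at h with hr
    rw [← Option.some.inj h, ← hr, inputPlace]
  · split_ifs at h with hr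
    rw [← Option.some.inj h, ← hr, inputPlace]
  · simp at h

theorem entry_eq_of_input_eq_some {r : Fin (2 ^ (2 * m))} {d : Reg m} {e : Entry (2 ^ m)}
    (h : (algorithm hm πA πB πC).input r d = some e) : d.entry = some e := by
  obtain rfl := (Prod.ext_iff.1 (eq_inputPlace_of_input_eq_some h)).2
  cases e <;> rfl

variable (hm πA πB πC) in
/-- The supersteps of `algorithm`, with the type of its registers made explicit. -/
noncomputable def steps : List (Step (2 * m) (Reg m)) :=
  (algorithm hm πA πB πC).steps

theorem mem_steps {st : Step (2 * m) (Reg m)} (h : st ∈ steps hm πA πB πC) :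
    (∃ i, ∃ hi : i < levels m, st = distStep πA πB i hi) ∨
      (∃ i, ∃ hi : i < levels m, st = collStep πC i hi) ∨ st = lastStep πC (levels_pos hm) := by
  simp only [steps, algorithm, List.mem_append, List.mem_map, List.mem_reverse, List.mem_finRange,
    true_and, List.mem_singleton] at h
  rcases h with (⟨i, rfl⟩ | ⟨i, rfl⟩) | rfl
  · exact .inl ⟨i, i.isLt, rfl⟩
  · exact .inr (.inl ⟨i, i.isLt, rfl⟩)
  · exact .inr (.inr rfl)

theorem exists_mem_prodCode_of_mem_code {st : Step (2 * m) (Reg m)}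
    (hst : st ∈ steps hm πA πB πC) {r : Fin (2 ^ (2 * m))} {op : Instr (Reg m)}
    (hop : op ∈ st.code r) : ∃ i, op ∈ prodCode πC i r := by
  rcases mem_steps hst with ⟨i, hi, rfl⟩ | ⟨i, hi, rfl⟩ | rfl
  · exact absurd hop List.not_mem_nil
  · exact ⟨_, hop⟩
  · exact ⟨_, hop⟩

theorem entry_target_eq_none {st : Step (2 * m) (Reg m)}
    (hst : st ∈ steps hm πA πB πC) {r : Fin (2 ^ (2 * m))} {op : Instr (Reg m)}
    (hop : op ∈ st.code r) : op.target.entry = none :=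
  have ⟨_, hop⟩ := exists_mem_prodCode_of_mem_code hst hop
  entry_target_eq_none_of_mem_prodCode hop

theorem entry_srcReg_of_mem_msgs {st : Step (2 * m) (Reg m)}
    (hst : st ∈ steps hm πA πB πC) {μ : Message (2 * m) (Reg m)} (hμ : μ ∈ st.msgs)
    {e : Entry (2 ^ m)} (he : μ.dstReg.entry = some e) : μ.srcReg.entry = some e := by
  have notMem_dummies (i : ℕ) (hμ : μ ∈ dummies m i) : False := by
    obtain ⟨t, ht⟩ := dummies_reg μ hμ
    simp [ht, Reg.entry] at he
  rcases mem_steps hst with ⟨i, hi, rfl⟩ | ⟨i, hi, rfl⟩ | rfl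
  · simp only [distStep, distMsgs, mem_union, mem_image] at hμ
    rcases hμ with (⟨w, -, rfl⟩ | ⟨w, -, rfl⟩) | hμ
    exacts [he, he, (notMem_dummies i hμ).elim]
  · simp only [collStep, collMsgs, mem_union, mem_image] at hμ
    rcases hμ with ⟨w, -, rfl⟩ | hμ
    exacts [he, (notMem_dummies i hμ).elim]
  · exact (notMem_dummies 0 hμ).elim

theorem onlyCopies_start {S : Type} [Semiring S] (inst : Entry (2 ^ m) → S) :
    OnlyCopies inst ((algorithm hm πA πB πC).start inst) := by
  intro r d e hd
  simp only [Algorithm.start]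
  cases hinput : (algorithm hm πA πB πC).input r d with
  | none => exact .inl rfl
  | some e' =>
    obtain rfl : e' = e :=
      Option.some.inj ((entry_eq_of_input_eq_some hinput).symm.trans hd)
    exact .inr rfl

theorem OnlyCopies.foldl_exec {S : Type} [Semiring S] {inst : Entry (2 ^ m) → S}
    {mem : Fin (2 ^ (2 * m)) → Reg m → S} (h : OnlyCopies inst mem)
    {l : List (Step (2 * m) (Reg m))} (hl : ∀ st ∈ l, st ∈ steps hm πA πB πC) :
    OnlyCopies inst (l.foldl Step.exec mem) := by
  induction l generalizing mem with
  | nil => exact h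
  | cons st l ih =>
    have hst := hl st List.mem_cons_self
    exact ih (h.exec (fun _ _ hop => entry_target_eq_none hst hop)
      fun _ hμ _ he => entry_srcReg_of_mem_msgs hst hμ he) fun st' h' =>
        hl st' (List.mem_cons_of_mem _ h')

theorem homeC_eq_of_mul_mem_code {before after : List (Step (2 * m) (Reg m))}
    {st : Step (2 * m) (Reg m)} (hsteps : steps hm πA πB πC = before ++ st :: after)
    {r : Fin (2 ^ (2 * m))} {code₁ code₂ : List (Instr (Reg m))} {d x y : Reg m}
    (hcode : st.code r = code₁ ++ Instr.mul d x y :: code₂) {a c b : Fin (2 ^ m)}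
    (hx : runCode code₁ (before.foldl Step.exec
      ((algorithm hm πA πB πC).start (FreeAlgebra.ι ℕ)) r) x = FreeAlgebra.ι ℕ (Entry.A a c))
    (hy : runCode code₁ (before.foldl Step.exec
      ((algorithm hm πA πB πC).start (FreeAlgebra.ι ℕ)) r) y = FreeAlgebra.ι ℕ (Entry.B c b)) :
    homeC πC (levels m) (blk (levels m) c) a b = r := by
  have hst : st ∈ steps hm πA πB πC := by simp [hsteps]
  obtain ⟨i, hmul⟩ := exists_mem_prodCode_of_mem_code hst (r := r) (op := .mul d x y)
    (by simp [hcode])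
  obtain ⟨a', c', b', hhome, hxA, hyB⟩ := mul_mem_prodCode hmul
  have copies : OnlyCopies (FreeAlgebra.ι ℕ)
      (before.foldl Step.exec ((algorithm hm πA πB πC).start (FreeAlgebra.ι ℕ))) :=
    (onlyCopies_start _).foldl_exec fun _ h => hsteps ▸ List.mem_append_left _ h
  have operand_eq {z : Reg m} {e e' : Entry (2 ^ m)} (hz : z.entry = some e)
      (hval : runCode code₁ (before.foldl Step.exec
        ((algorithm hm πA πB πC).start (FreeAlgebra.ι ℕ)) r) z = FreeAlgebra.ι ℕ e') : e' = e := by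
    rw [runCode_eq_of_entry_eq_some (fun op hop => entry_target_eq_none hst (r := r)
      (by simp [hcode, hop])) hz] at hval
    have copy := copies r z e hz
    rw [hval] at copy
    exact FreeAlgebra.ι_injective (copy.resolve_left (FreeAlgebra.ι_ne_zero _))
  obtain ⟨rfl, rfl⟩ := Entry.A.inj (operand_eq hxA hx)
  obtain ⟨-, rfl⟩ := Entry.B.inj (operand_eq hyB hy)
  exact hhome

theorem homeC_eq_of_computes {r : Fin (2 ^ (2 * m))} {t : Fin (2 ^ m) × Fin (2 ^ m) × Fin (2 ^ m)}
    (h : (algorithm hm πA πB πC).Computes r t) :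
    homeC πC (levels m) (blk (levels m) t.2.1) t.1 t.2.2 = r :=
  have ⟨_, _, _, _, _, _, _, _, hsteps, hcode, hx, hy⟩ := h
  homeC_eq_of_mul_mem_code hsteps hcode hx hy

variable (hm πA πB πC)

theorem algorithm_noReplication : (algorithm hm πA πB πC).NoReplication := fun _ _ _ _ _ h h' =>
  Prod.mk.inj ((eq_inputPlace_of_input_eq_some h).trans (eq_inputPlace_of_input_eq_some h').symm)

theorem algorithm_evenTerms : (algorithm hm πA πB πC).EvenTerms := by
  intro r
  have ncard_le : {t | (algorithm hm πA πB πC).Computes r t}.ncard ≤ 2 ^ m := by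
    refine le_trans ?_ (card_homeC_levels_eq_le πC r)
    rw [← Set.ncard_coe_finset]
    exact Set.ncard_le_ncard (fun t ht => by simpa using homeC_eq_of_computes ht) (Set.toFinite _)
  calc _ ≤ 2 ^ m * 2 ^ (2 * m) := Nat.mul_le_mul_right _ ncard_le
    _ = (2 ^ m) ^ 3 := by ring

theorem algorithm_inClass : (algorithm hm πA πB πC).InClass :=
  Algorithm.inClass_of_evenTerms (algorithm_solves hm πA πB πC)
    (algorithm_noReplication hm πA πB πC) (algorithm_evenTerms hm πA πB πC)

theorem fold_inClass {k : ℕ} (hk : k ≤ 2 * m) : ((algorithm hm πA πB πC).fold hk).InClass :=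
  Algorithm.inClass_of_evenTerms ((algorithm_solves hm πA πB πC).fold hk)
    ((algorithm_noReplication hm πA πB πC).fold hk) ((algorithm_evenTerms hm πA πB πC).fold hk)

end Algorithm

end MM

/-! ### Degrees of folded steps -/

theorem card_filter_image_le {α β : Type*} [DecidableEq β] (s : Finset α) (f : α → β)
    (p : β → Prop) [DecidablePred p] :
    ((s.image f).filter p).card ≤ (s.filter fun a => p (f a)).card := by
  rw [Finset.filter_image]
  exact Finset.card_image_le

theorem card_filter_union_le {α : Type*} [DecidableEq α] {s t : Finset α} {p : α → Prop}
    [DecidablePred p] {a b : ℕ} (hs : (s.filter p).card ≤ a) (ht : (t.filter p).card ≤ b) :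
    ((s ∪ t).filter p).card ≤ a + b := by
  rw [Finset.filter_union]
  exact (Finset.card_union_le _ _).trans (Nat.add_le_add hs ht)

namespace Algorithm

open Finset

variable {k j : ℕ} {Reg : Type}

theorem card_block_eq_msgs_le (hj : j ≤ k) {msgs : Finset (Message k Reg)}
    {place : Message k Reg → Fin (2 ^ k)} {D : ℕ} (h : ∀ r, #{μ ∈ msgs | place μ = r} ≤ D)
    (R : Fin (2 ^ j)) : #{μ ∈ msgs | block hj (place μ) = R} ≤ D * 2 ^ (k - j) := by
  calc #{μ ∈ msgs | block hj (place μ) = R}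
      ≤ D * #{r : Fin (2 ^ k) | block hj r = R} := by
        refine card_le_mul_card_image_of_maps_to (f := place) (fun μ hμ => ?_) D fun r _ => ?_
        · exact mem_filter.2 ⟨mem_univ _, (mem_filter.1 hμ).2⟩
        · exact (card_le_card (filter_subset_filter _ (filter_subset _ _))).trans (h r)
    _ ≤ D * 2 ^ (k - j) := Nat.mul_le_mul_left _ (card_block_eq_le hj R)

theorem degree_foldStep_le (hj : j ≤ k) {st : Step k Reg} {D : ℕ}
    (hsrc : ∀ r, #{μ ∈ st.msgs | μ.src = r} ≤ D) (hdst : ∀ r, #{μ ∈ st.msgs | μ.dst = r} ≤ D) :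
    (foldStep hj st).degree ≤ D * 2 ^ (k - j) := by
  classical
  refine Finset.sup_le fun R _ => max_le ?_ ?_
  · exact ((card_le_card (monotone_filter_right _ fun _ _ h => h.1)).trans
      (card_filter_image_le _ _ _)).trans (card_block_eq_msgs_le hj hsrc R)
  · exact ((card_le_card (monotone_filter_right _ fun _ _ h => h.1)).trans
      (card_filter_image_le _ _ _)).trans (card_block_eq_msgs_le hj hdst R)

theorem card_src_le_degree_foldStep (hj : j ≤ k) (st : Step k Reg) (R : Fin (2 ^ j)) :
    #{μ ∈ st.msgs | block hj μ.src = R ∧ block hj μ.dst ≠ R} ≤ (foldStep hj st).degree := by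
  classical
  refine le_trans (card_le_card_of_injOn (fun μ =>
    ⟨block hj μ.src, block hj μ.dst, (μ.src, μ.srcReg), (μ.dst, μ.dstReg)⟩) ?_ ?_)
    ((foldStep hj st).card_src_le_degree R)
  · intro μ hμ
    obtain ⟨hμ, hplace⟩ := mem_filter.1 (mem_coe.1 hμ)
    exact mem_coe.2 (mem_filter.2 ⟨mem_image_of_mem _ hμ, hplace⟩)
  · rintro ⟨⟩ _ ⟨⟩ _ h
    simp_all

end Algorithm

namespace MM

open Finset

variable {m i : ℕ}

theorem card_parent_eq_le {home : ℕ → Fin (2 ^ m) → Fin (2 ^ m) → Fin (2 ^ (2 * m))}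
    {r : Fin (2 ^ (2 * m))} {D : ℕ} (h : #{w ∈ triples m i | home w.2.2 w.1 w.2.1 = r} ≤ D) :
    #{w ∈ triples m (i + 1) | home (w.2.2 / 2) w.1 w.2.1 = r} ≤ 2 * D := by
  refine le_trans ?_ ((card_product (range 2) _).trans_le (Nat.mul_le_mul_left 2 h))
  refine card_le_card_of_injOn (fun w => (w.2.2 % 2, w.1, w.2.1, w.2.2 / 2)) ?_ ?_
  · rintro ⟨a, b, y⟩ hw
    simp only [triples, coe_filter, mem_product, mem_univ, true_and, mem_range,
      Set.mem_ofPred_eq, coe_product, Set.mem_prod, mem_coe, pow_succ] at hw ⊢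
    exact ⟨Nat.mod_lt _ two_pos, by omega, hw.2⟩
  · rintro ⟨a, b, y⟩ _ ⟨a', b', y'⟩ _ h
    simp only [Prod.mk.injEq] at h ⊢
    exact ⟨h.2.1, h.2.2.1, by omega⟩

/-- The `w.2`-th dummy message that the PE number `w.1` sends in a `3i`-superstep. -/
def dummyMsg (m i : ℕ) (w : ℕ × ℕ) : Message (2 * m) (Reg m) :=
  ⟨Fin.ofNat _ w.1, Fin.ofNat _ (w.1 + 2 ^ (2 * m) / 2 ^ (3 * i + 1)), .dummy w.2, .dummy w.2⟩

theorem dummyMsg_src_val (hi : i < levels m) {w : ℕ × ℕ}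
    (hw : w.1 < 2 ^ (2 * m) / 2 ^ (3 * i + 1)) :
    (dummyMsg m i w).src.val = w.1 :=
  Nat.mod_eq_of_lt (dummies_bound (level_le hi).2 hw).1

theorem dummyMsg_dst_val (hi : i < levels m) {w : ℕ × ℕ}
    (hw : w.1 < 2 ^ (2 * m) / 2 ^ (3 * i + 1)) :
    (dummyMsg m i w).dst.val = w.1 + 2 ^ (2 * m) / 2 ^ (3 * i + 1) :=
  Nat.mod_eq_of_lt (dummies_bound (level_le hi).2 hw).2.1

theorem card_dummies_eq_le {place : Message (2 * m) (Reg m) → Fin (2 ^ (2 * m))} {shift : ℕ}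
    (hplace : ∀ w : ℕ × ℕ, w.1 < 2 ^ (2 * m) / 2 ^ (3 * i + 1) →
      (place (dummyMsg m i w)).val = w.1 + shift) (r : Fin (2 ^ (2 * m))) :
    #{μ ∈ dummies m i | place μ = r} ≤ 2 ^ i := by
  classical
  refine (card_filter_image_le _ (dummyMsg m i) _).trans ?_
  refine (card_le_card_of_injOn Prod.snd
    (fun w hw => (mem_product.1 (mem_filter.1 (mem_coe.1 hw)).1).2) ?_).trans_eq (card_range _)
  rintro ⟨t, u⟩ hw ⟨t', u'⟩ hw' (rfl : u = u')
  simp only [coe_filter, mem_product, mem_range, Set.mem_ofPred_eq] at hw hw'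
  have shift_eq := congrArg Fin.val (hw.2.trans hw'.2.symm)
  rw [hplace _ hw.1.1, hplace _ hw'.1.1] at shift_eq
  exact Prod.ext (Nat.add_right_cancel shift_eq) rfl

theorem card_dummies_src_eq_le (hi : i < levels m) (r : Fin (2 ^ (2 * m))) :
    #{μ ∈ dummies m i | μ.src = r} ≤ 2 ^ i :=
  card_dummies_eq_le (shift := 0) (fun _ => dummyMsg_src_val hi) r

theorem card_dummies_dst_eq_le (hi : i < levels m) (r : Fin (2 ^ (2 * m))) :
    #{μ ∈ dummies m i | μ.dst = r} ≤ 2 ^ i :=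
  card_dummies_eq_le (fun _ => dummyMsg_dst_val hi) r

/-- A superstep of level `i` in which every PE sends and receives `O(2 ^ i)` messages and which
contains the dummy messages. -/
structure IsRegular (st : Step (2 * m) (Reg m)) (i : ℕ) : Prop where
  lt : i < levels m
  label : st.label = 3 * i
  dummies_subset : dummies m i ⊆ st.msgs
  card_src_le : ∀ r, #{μ ∈ st.msgs | μ.src = r} ≤ 5 * 2 ^ i
  card_dst_le : ∀ r, #{μ ∈ st.msgs | μ.dst = r} ≤ 5 * 2 ^ i

theorem isRegular_distStep (πA πB : Layout m) (hi : i < levels m) :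
    IsRegular (distStep πA πB i hi) i := by
  classical
  have hi' := (level_le hi).1
  refine ⟨hi, rfl, subset_union_right, fun r => ?_, fun r => ?_⟩
  · have copies_A := card_parent_eq_le (home := homeA πA i)
      (card_homeA_eq_le (Nat.le_of_lt hi') πA r)
    have copies_B := card_parent_eq_le (home := homeB πB i)
      (card_homeB_eq_le (Nat.le_of_lt hi') πB r)
    refine (card_filter_union_le (card_filter_union_le
      ((card_filter_image_le ..).trans copies_A) ((card_filter_image_le ..).trans copies_B))
      (card_dummies_src_eq_le hi r)).trans_eq ?_
    ring
  · refine (card_filter_union_le (card_filter_union_le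
      ((card_filter_image_le ..).trans (card_homeA_eq_le hi' πA r))
      ((card_filter_image_le ..).trans (card_homeB_eq_le hi' πB r)))
      (card_dummies_dst_eq_le hi r)).trans_eq ?_
    ring

theorem isRegular_collStep (πC : Layout m) (hi : i < levels m) :
    IsRegular (collStep πC i hi) i := by
  classical
  have hi' := (level_le hi).1
  refine ⟨hi, rfl, subset_union_right, fun r => ?_, fun r => ?_⟩
  · refine (card_filter_union_le
      ((card_filter_image_le ..).trans (card_homeC_eq_le hi' πC r))
      (card_dummies_src_eq_le hi r)).trans ?_
    rw [pow_succ]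
    omega
  · have products := card_parent_eq_le (home := homeC πC i)
      (card_homeC_eq_le (Nat.le_of_lt hi') πC r)
    refine (card_filter_union_le ((card_filter_image_le ..).trans products)
      (card_dummies_dst_eq_le hi r)).trans ?_
    omega

theorem isRegular_lastStep (πC : Layout m) (h : 0 < levels m) : IsRegular (lastStep πC h) 0 :=
  ⟨h, rfl, Subset.refl _, fun r => (card_dummies_src_eq_le h r).trans (by norm_num),
    fun r => (card_dummies_dst_eq_le h r).trans (by norm_num)⟩

theorem exists_isRegular {hm : 1 ≤ m} {πA πB πC : Layout m} {st : Step (2 * m) (Reg m)}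
    (h : st ∈ steps hm πA πB πC) : ∃ i, IsRegular st i := by
  rcases mem_steps h with ⟨i, hi, rfl⟩ | ⟨i, hi, rfl⟩ | rfl
  exacts [⟨i, isRegular_distStep πA πB hi⟩, ⟨i, isRegular_collStep πC hi⟩,
    ⟨0, isRegular_lastStep πC _⟩]

namespace IsRegular

variable {st : Step (2 * m) (Reg m)} {j : ℕ}

theorem degree_foldStep_le (h : IsRegular st i) (hj : j ≤ 2 * m) :
    (Algorithm.foldStep hj st).degree ≤ 5 * 2 ^ i * 2 ^ (2 * m - j) :=
  Algorithm.degree_foldStep_le hj h.card_src_le h.card_dst_le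

-- The dummy messages of the first `n / 2 ^ j` PEs all leave their block.
theorem le_degree_foldStep (h : IsRegular st i) (hj : j ≤ 2 * m) (hij : 3 * i < j) :
    2 ^ i * 2 ^ (2 * m - j) ≤ (Algorithm.foldStep hj st).degree := by
  classical
  have block_size_le : 2 ^ (2 * m - j) ≤ 2 ^ (2 * m) / 2 ^ (3 * i + 1) := by
    rw [Nat.pow_div (level_le h.lt).2 two_pos]
    exact Nat.pow_le_pow_right two_pos (by omega)
  rw [mul_comm, ← card_range (2 ^ (2 * m - j)), ← card_range (2 ^ i), ← card_product]
  refine le_trans (card_le_card_of_injOn (dummyMsg m i) ?_ ?_)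
    (Algorithm.card_src_le_degree_foldStep hj st 0)
  · rintro ⟨t, u⟩ hw
    obtain ⟨ht, hu⟩ := mem_product.1 (mem_coe.1 hw)
    have ht' := (mem_range.1 ht).trans_le block_size_le
    refine mem_coe.2 (mem_filter.2 ⟨h.dummies_subset (mem_image_of_mem (dummyMsg m i)
      (mem_product.2 ⟨mem_range.2 ht', hu⟩)), Fin.ext ?_, fun hdst => ?_⟩)
    · simpa [Algorithm.block, dummyMsg_src_val h.lt ht'] using ht
    · have hdst := congrArg Fin.val hdst
      simp only [Algorithm.block, dummyMsg_dst_val h.lt ht', Fin.val_zero] at hdst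
      exact absurd (Nat.le_add_left _ _) (block_size_le.trans_lt' <|
        (Nat.div_eq_zero_iff_lt (by positivity)).1 hdst).not_ge
  · rintro ⟨t, u⟩ hw ⟨t', u'⟩ hw' heq
    have src_eq := congrArg (fun μ => μ.src.val) heq
    have reg_eq := congrArg Message.srcReg heq
    simp only [dummyMsg_src_val h.lt ((mem_range.1 (mem_product.1 hw).1).trans_le block_size_le),
      dummyMsg_src_val h.lt ((mem_range.1 (mem_product.1 hw').1).trans_le block_size_le)] at src_eq
    exact Prod.ext src_eq (Reg.dummy.inj reg_eq)

end IsRegular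

end MM

/-! ### Wiseness and communication complexity -/

namespace Algorithm

open Finset

variable {k j N : ℕ}

theorem sum_cumDegree_fold (𝒜 : Algorithm k N) (hj : j ≤ k) (n : ℕ) :
    ∑ i ∈ range n, ((𝒜.fold hj).cumDegree i : ℝ) =
      ((𝒜.steps.filter fun st => st.label < n).map fun st =>
        ((foldStep hj st).degree : ℝ)).sum := by
  rw [← Nat.cast_sum]
  simp only [cumDegree]
  rw [sum_range_sum_map_filter_eq, Nat.cast_list_sum]
  simp only [fold, List.filter_map, List.map_map]
  rfl

theorem commComplexity_fold (𝒜 : Algorithm k N) (hj : j ≤ k) (σ : ℝ) :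
    (𝒜.fold hj).commComplexity σ =
      ((𝒜.steps.filter fun st => st.label < j).map fun st =>
        ((foldStep hj st).degree : ℝ) + σ).sum := by
  rw [commComplexity_eq_sum]
  simp only [fold, List.filter_map, List.map_map]
  rfl

theorem isWise_of_degree_foldStep_le {𝒜 : Algorithm k N} {α : ℝ} {l : ℕ} (hl : l ≤ k)
    (hα : 0 < α) (hα' : α ≤ 1) (hl1 : 1 ≤ l)
    (h : ∀ st ∈ 𝒜.steps, ∀ (j : ℕ) (hj : j ≤ l), st.label < j →
      α * (2 : ℝ) ^ (l - j) * (foldStep hl st).degree ≤ (foldStep (hj.trans hl) st).degree) :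
    𝒜.IsWise α hl := by
  refine ⟨hα, hα', hl1, fun j _ hj => ?_⟩
  rw [sum_cumDegree_fold, sum_cumDegree_fold, ← List.sum_map_mul_left]
  refine List.sum_le_sum fun st hst => ?_
  obtain ⟨hst, hlabel⟩ := List.mem_filter.1 hst
  rw [div_eq_mul_inv, ← pow_sub₀ (2 : ℝ) two_ne_zero hj]
  exact h st hst j hj (of_decide_eq_true hlabel)

end Algorithm

namespace MM

open Finset

variable {m : ℕ} (hm : 1 ≤ m) (πA πB πC : Layout m)

theorem algorithm_isWise : (algorithm hm πA πB πC).IsWise (1 / 5) (le_refl (2 * m)) := by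
  refine Algorithm.isWise_of_degree_foldStep_le _ (by norm_num) (by norm_num) (by omega)
    fun st hst j hj hlabel => ?_
  obtain ⟨i, hi⟩ := exists_isRegular hst
  have degree_le := hi.degree_foldStep_le le_rfl
  rw [Nat.sub_self, pow_zero, mul_one] at degree_le
  calc 1 / 5 * (2 : ℝ) ^ (2 * m - j) * (Algorithm.foldStep le_rfl st).degree
      ≤ 1 / 5 * (2 : ℝ) ^ (2 * m - j) * (5 * 2 ^ i) := by gcongr; exact_mod_cast degree_le
    _ = 2 ^ i * 2 ^ (2 * m - j) := by ring
    _ ≤ (Algorithm.foldStep hj st).degree := by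
      exact_mod_cast hi.le_degree_foldStep hj (hi.label ▸ hlabel)

theorem sum_map_label_steps {k : ℕ} (hk1 : 1 ≤ k) (hk : k ≤ 2 * m) (f : ℕ → ℝ) :
    (((steps hm πA πB πC).filter fun st => st.label < k).map fun st => f st.label).sum =
      2 * ∑ i ∈ range ((k + 2) / 3), f (3 * i) + f 0 := by
  have level_sum : ∑ i : Fin (levels m), (if 3 * i.val < k then f (3 * i) else 0) =
      ∑ i ∈ range ((k + 2) / 3), f (3 * i) := by
    rw [Fin.sum_univ_eq_sum_range (fun i => if 3 * i < k then f (3 * i) else 0), ← sum_filter]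
    congr 1
    ext i
    simp only [levels, mem_filter, mem_range]
    omega
  rw [sum_map_filter_eq_sum_map_ite]
  simp only [steps, algorithm, List.map_append, List.sum_append, List.map_map, Function.comp_def,
    List.map_reverse, List.sum_reverse, List.map_cons, List.map_nil, List.sum_cons, List.sum_nil,
    distStep, collStep, lastStep, ← Fin.sum_univ_def, level_sum, if_pos (Nat.lt_of_succ_le hk1)]
  ring

theorem commComplexity_fold_le_sum {k : ℕ} (hk1 : 1 ≤ k) (hk : k ≤ 2 * m) {σ : ℝ} (hσ : 0 ≤ σ) :
    ((algorithm hm πA πB πC).fold hk).commComplexity σ ≤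
      3 * ∑ i ∈ range ((k + 2) / 3), (5 * 2 ^ i * 2 ^ (2 * m - k) + σ) := by
  set cost : ℕ → ℝ := fun i => 5 * 2 ^ i * 2 ^ (2 * m - k) + σ
  have cost_nonneg (i : ℕ) : 0 ≤ cost i := by positivity
  have step_le {st : Step (2 * m) (Reg m)} (hst : st ∈ steps hm πA πB πC) :
      ((Algorithm.foldStep hk st).degree : ℝ) + σ ≤ cost (st.label / 3) := by
    obtain ⟨i, hi⟩ := exists_isRegular hst
    rw [hi.label, Nat.mul_div_cancel_left i three_pos]
    have degree_le : ((Algorithm.foldStep hk st).degree : ℝ) ≤ 5 * 2 ^ i * 2 ^ (2 * m - k) := by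
      exact_mod_cast hi.degree_foldStep_le hk
    exact add_le_add_left degree_le σ
  calc _ = (((steps hm πA πB πC).filter fun st => st.label < k).map fun st =>
        ((Algorithm.foldStep hk st).degree : ℝ) + σ).sum := Algorithm.commComplexity_fold ..
    _ ≤ (((steps hm πA πB πC).filter fun st => st.label < k).map fun st =>
        cost (st.label / 3)).sum :=
      List.sum_le_sum fun st hst => step_le (List.mem_filter.1 hst).1
    _ = 2 * ∑ i ∈ range ((k + 2) / 3), cost i + cost 0 := by
      rw [sum_map_label_steps hm πA πB πC hk1 hk fun l => cost (l / 3)]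
      simp only [Nat.mul_div_cancel_left _ three_pos, Nat.zero_div]
    _ ≤ 3 * ∑ i ∈ range ((k + 2) / 3), cost i := by
      have := single_le_sum (fun i _ => cost_nonneg i)
        (mem_range.2 (by omega : 0 < (k + 2) / 3))
      linarith

theorem commComplexity_fold_le {k : ℕ} (hk1 : 1 ≤ k) (hk : k ≤ 2 * m) {σ : ℝ} (hσ : 0 ≤ σ) :
    ((algorithm hm πA πB πC).fold hk).commComplexity σ ≤
      30 * ((2 : ℝ) ^ (2 * m) / ((2 : ℝ) ^ k) ^ (2 / 3 : ℝ) + σ * lg ((2 : ℝ) ^ k)) := by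
  have geometric_sum : ∑ i ∈ range ((k + 2) / 3), (2 : ℝ) ^ i ≤ 2 ^ ((k + 2) / 3) := by
    rw [geom_sum_eq (by norm_num)]
    norm_num
  have volume_le : (2 : ℝ) ^ ((k + 2) / 3) * 2 ^ (2 * m - k) ≤
      2 * (2 ^ (2 * m) / ((2 : ℝ) ^ k) ^ (2 / 3 : ℝ)) := by
    rw [← mul_div_assoc, le_div_iff₀ (by positivity), ← pow_sub_mul_pow (2 : ℝ) hk]
    linarith [mul_le_mul_of_nonneg_left (two_pow_mul_rpow_two_thirds_le k)
      (show (0 : ℝ) ≤ 2 ^ (2 * m - k) by positivity)]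
  have levels_le_lg : (((k + 2) / 3 : ℕ) : ℝ) ≤ lg ((2 : ℝ) ^ k) := by
    rw [lg_two_pow hk1]
    exact_mod_cast (by omega : (k + 2) / 3 ≤ k)
  calc _ ≤ 3 * ∑ i ∈ range ((k + 2) / 3), (5 * (2 : ℝ) ^ i * 2 ^ (2 * m - k) + σ) :=
        commComplexity_fold_le_sum hm πA πB πC hk1 hk hσ
    _ = 15 * ((∑ i ∈ range ((k + 2) / 3), (2 : ℝ) ^ i) * 2 ^ (2 * m - k)) +
        3 * (σ * ((k + 2) / 3 : ℕ)) := by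
      rw [sum_add_distrib, ← sum_mul, ← mul_sum, sum_const, card_range, nsmul_eq_mul]
      ring
    _ ≤ 15 * (2 ^ ((k + 2) / 3) * 2 ^ (2 * m - k)) + 3 * (σ * lg ((2 : ℝ) ^ k)) := by gcongr
    _ ≤ _ := by
      have : 0 ≤ σ * lg ((2 : ℝ) ^ k) := mul_nonneg hσ (zero_le_one.trans (le_max_left _ _))
      linarith

theorem fold_isOptimal {k : ℕ} (hk1 : 1 ≤ k) (hk : k ≤ 2 * m) {σ K : ℝ} (hσ : 0 ≤ σ) (hK : 0 ≤ K)
    (hσK : σ ≤ K * ((2 : ℝ) ^ (2 * m) / (((2 : ℝ) ^ k) ^ (2 / 3 : ℝ) * lg ((2 : ℝ) ^ k)))) :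
    ((algorithm hm πA πB πC).fold hk).IsOptimal (1 / (1500 * (1 + K))) σ := by
  have lg_pos : 0 < lg ((2 : ℝ) ^ k) := one_pos.trans_le (le_max_left _ _)
  have latency_le : σ * lg ((2 : ℝ) ^ k) ≤
      K * ((2 : ℝ) ^ (2 * m) / ((2 : ℝ) ^ k) ^ (2 / 3 : ℝ)) :=
    (mul_le_mul_of_nonneg_right hσK lg_pos.le).trans_eq (by field_simp)
  have input_size : ((2 ^ m : ℕ) : ℝ) ^ 2 = 2 ^ (2 * m) := by
    push_cast
    rw [← pow_mul, mul_comm]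
  rw [show 1500 * (1 + K) = 50 * (30 * (1 + K)) by ring]
  refine (fold_inClass hm πA πB πC hk).isOptimal_of_commComplexity_le hk1 hσ (by positivity) ?_
  rw [input_size]
  linarith [commComplexity_fold_le hm πA πB πC hk1 hk hσ]

end MM

theorem mainTheorem3 :
    -- the algorithm belongs to the class (in particular, it multiplies matrices)
    (∀ (m : ℕ) (hm : 1 ≤ m) (πA πB πC : MM.Layout m),
      (MM.algorithm hm πA πB πC).InClass) ∧
    -- communication complexity `O(n / p ^ (2/3) + σ log p)` on `M(p, σ)`
    (∃ c : ℝ, 0 < c ∧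
      ∀ (m : ℕ) (hm : 1 ≤ m) (πA πB πC : MM.Layout m) (k : ℕ) (_ : 1 ≤ k) (hk : k ≤ 2 * m)
        (σ : ℝ), 0 ≤ σ →
        ((MM.algorithm hm πA πB πC).fold hk).commComplexity σ ≤
          c * ((2 : ℝ) ^ (2 * m) / ((2 : ℝ) ^ k) ^ (2 / 3 : ℝ) + σ * lg ((2 : ℝ) ^ k))) ∧
    -- `(Θ(1), n)`-wiseness
    (∃ α : ℝ, ∀ (m : ℕ) (hm : 1 ≤ m) (πA πB πC : MM.Layout m),
      (MM.algorithm hm πA πB πC).IsWise α (le_refl (2 * m))) ∧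
    -- `Θ(1)`-optimality on `M(p, σ)` for `σ = O(n / (p ^ (2/3) log p))`
    (∀ K : ℝ, 0 < K → ∃ β : ℝ, 0 < β ∧ β ≤ 1 ∧
      ∀ (m : ℕ) (hm : 1 ≤ m) (πA πB πC : MM.Layout m) (k : ℕ) (_ : 1 ≤ k) (hk : k ≤ 2 * m)
        (σ : ℝ), 0 ≤ σ →
        σ ≤ K * ((2 : ℝ) ^ (2 * m) / (((2 : ℝ) ^ k) ^ (2 / 3 : ℝ) * lg ((2 : ℝ) ^ k))) →
        ((MM.algorithm hm πA πB πC).fold hk).IsOptimal β σ) := by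
  refine ⟨fun m hm πA πB πC => MM.algorithm_inClass hm πA πB πC,
    ⟨30, by norm_num, fun m hm πA πB πC k hk1 hk σ hσ =>
      MM.commComplexity_fold_le hm πA πB πC hk1 hk hσ⟩,
    ⟨1 / 5, fun m hm πA πB πC => MM.algorithm_isWise hm πA πB πC⟩,
    fun K hK => ⟨1 / (1500 * (1 + K)), by positivity, ?_,
      fun m hm πA πB πC k hk1 hk σ hσ hσK =>
        MM.fold_isOptimal hm πA πB πC hk1 hk hσ hK.le hσK⟩⟩
  rw [div_le_one (by positivity)]
  linarith
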